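/- **Setting.** For $U\in\mathbb R^{n\times m}$ with columns $u_1,\dots,u_m$ and $d\ge 1$, let $U^{\circledast d}\in\mathbb R^{n^d\times\binom{m+d-1}{d}}$ be the matrix whose columns are indexed by tuples $1\le i_1\le\dots\le i_d\le m$, the column of $(i_1,\dots,i_d)$ being $\frac1{d!}\sum_{\pi\in S_d}u_{i_{\pi(1)}}\otimes\cdots\otimes u_{i_{\pi(d)}}$. Let $\sigma_k$ denote the $k$-th largest singular value. **Theorem (robust linear independence of subspace lifts).** For every integer $d\ge1$ there are a constant $c_d>0$ and an exponent $A\in\mathbb N$, depending only on $d$, such that for every $\delta>0$ there are constants $\kappa,c>0$, depending only on $d$ and $\delta$, for which the following holds. Let $n,m,s$ be integers with $1\le m<n$ and $s\ge1$ such that $$s\binom{m+d-1}{d}\le\delta\binom{n+d-1}{d}\qquad\text{and}\qquad m\le(1-\delta)\,c_d\,n .$$ Let $\rho>0$, let $P_1,\dots,P_s\in\mathbb R^{n\times m}$ be arbitrary matrices with orthonormal columns, and let $G_1,\dots,G_s\in\mathbb R^{n\times m}$ be independent random matrices with i.i.d. entries distributed as $\mathcal N(0,\rho^2/n)$. Let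 $\widehat W_i\subseteq\mathbb R^n$ be the column span of $P_i+G_i$. Then, with probability at least $1-\exp(-cn)$, every $\widehat W_i$ has dimension $m$ and, for every choice of matrices $V_1,\dots,V_s\in\mathbb R^{n\times m}$ such that the columns of $V_i$ form an orthonormal basis of $\widehat W_i$, the block matrix $M=[\,V_1^{\circledast d}\ \cdots\ V_s^{\circledast d}\,]$ satisfies $$\sigma_{\min}(M)=\sigma_{s\binom{m+d-1}{d}}(M)\ \ge\ \kappa\left(\frac{\min\{\rho,1\}}{n}\right)^{A}.$$ -/

import Mathlib

open MeasureTheory ProbabilityTheory Matrix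

namespace SubspaceLift

/-- Nondecreasing tuples `i₁ ≤ i₂ ≤ ⋯ ≤ i_d` of elements of `{1, …, m}` (here `Fin m`). -/
abbrev NondecTuple (d m : ℕ) : Type :=
  {i : Fin d → Fin m // ∀ a b : Fin d, a ≤ b → i a ≤ i b}

/-- There are `C(m+d-1, d)` nondecreasing tuples. -/
theorem card_nondecTuple (d m : ℕ) :
    Fintype.card (NondecTuple d m) = (m + d - 1).choose d := by
  have h : Fintype.card (NondecTuple d m) = Fintype.card (Sym (Fin m) d) := by
    refine Fintype.card_of_bijective
      (f := fun i => (⟨(List.ofFn i.1 : Multiset (Fin m)), by simp⟩ : Sym (Fin m) d)) ⟨?_, ?_⟩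
    · intro f g hfg
      have h1 : (List.ofFn f.1).Perm (List.ofFn g.1) :=
        Multiset.coe_eq_coe.1 (congrArg Subtype.val hfg)
      have hf : (List.ofFn f.1).SortedLE :=
        List.sortedLE_ofFn_iff.2 fun a b hab => f.2 a b hab
      have hg : (List.ofFn g.1).SortedLE :=
        List.sortedLE_ofFn_iff.2 fun a b hab => g.2 a b hab
      exact Subtype.ext (List.ofFn_injective (h1.eq_of_pairwise' hf.pairwise hg.pairwise))
    · rintro ⟨t, ht⟩
      subst ht
      have hlen : (t.sort (· ≤ ·)).length = Multiset.card t := by simp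
      refine ⟨⟨fun a => (t.sort (· ≤ ·)).get (a.cast hlen.symm), fun a b hab => ?_⟩, ?_⟩
      · exact (Multiset.pairwise_sort t (· ≤ ·)).sortedLE.monotone_get (by simpa using hab)
      · apply Subtype.ext
        have : List.ofFn (fun a : Fin (Multiset.card t) =>
            (t.sort (· ≤ ·)).get (a.cast hlen.symm)) = t.sort (· ≤ ·) := by
          apply List.ext_get <;> simp
        simp only [this, Multiset.sort_eq]
  rw [h, Sym.card_sym_eq_choose, Fintype.card_fin]

/-- The symmetrized Kronecker power `U^{⊛d}` of an `n × m` matrix with columns `u₁, …, u_m`.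
Rows are indexed by the coordinates of `(ℝⁿ)^{⊗d}`, columns by nondecreasing tuples, and the column
of `(i₁, …, i_d)` is `(1/d!) ∑_{π ∈ S_d} u_{i_{π(1)}} ⊗ ⋯ ⊗ u_{i_{π(d)}}`. -/
noncomputable def symKronPow {n m : ℕ} (d : ℕ) (U : Matrix (Fin n) (Fin m) ℝ) :
    Matrix (Fin d → Fin n) (NondecTuple d m) ℝ :=
  Matrix.of fun r i =>
    (1 / (d.factorial : ℝ)) * ∑ π : Equiv.Perm (Fin d), ∏ j : Fin d, U (r j) (i.1 (π j))

/-- The block matrix `[V₁^{⊛d} V₂^{⊛d} ⋯ V_s^{⊛d}]`. -/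
noncomputable def blockLift {s n m : ℕ} (d : ℕ) (V : Fin s → Matrix (Fin n) (Fin m) ℝ) :
    Matrix (Fin d → Fin n) (Fin s × NondecTuple d m) ℝ :=
  Matrix.of fun r c => symKronPow d (V c.1) r c.2

/-- The `k`-th largest singular value `σ_k(A)`, for `k ≥ 1` (Mathlib's sequence starts at `0`). -/
noncomputable def singularValue {α β : Type*} [Fintype α] [Fintype β] [DecidableEq β]
    (A : Matrix α β ℝ) (k : ℕ) : ℝ :=
  A.toEuclideanLin.singularValues (k - 1)

/-- The least singular value `σ_min(A) = σ_k(A)`, where `k` is the number of columns of `A`. -/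
noncomputable def leastSingularValue {α β : Type*} [Fintype α] [Fintype β] [DecidableEq β]
    (A : Matrix α β ℝ) : ℝ :=
  singularValue A (Fintype.card β)

theorem leastSingularValue_blockLift {s n m : ℕ} (d : ℕ) (V : Fin s → Matrix (Fin n) (Fin m) ℝ) :
    leastSingularValue (blockLift d V)
      = singularValue (blockLift d V) (s * (m + d - 1).choose d) := by
  rw [leastSingularValue, Fintype.card_prod, Fintype.card_fin, card_nondecTuple]

/-- The column span of a matrix. -/
def colSpan {n m : ℕ} (A : Matrix (Fin n) (Fin m) ℝ) : Submodule ℝ (Fin n → ℝ) :=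
  Submodule.span ℝ (Set.range fun j : Fin m => fun i : Fin n => A i j)

/-- The columns of `V` are an orthonormal basis of the subspace `W` of `ℝⁿ`. -/
def IsOrthonormalBasisOf {n m : ℕ} (V : Matrix (Fin n) (Fin m) ℝ)
    (W : Submodule ℝ (Fin n → ℝ)) : Prop :=
  Vᵀ * V = 1 ∧ colSpan V = W

/-- The joint law of independent `n × m` random matrices `G₁, …, G_s`, each with i.i.d. entries
of law `N(0, ρ²/n)`. -/
noncomputable def gaussianBlocks (s n m : ℕ) (ρ : ℝ) :
    Measure (Fin s → Fin n → Fin m → ℝ) :=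
  Measure.pi fun _ => Measure.pi fun _ => Measure.pi fun _ =>
    gaussianReal 0 (Real.toNNReal (ρ ^ 2 / n))

end SubspaceLift

open SubspaceLift

/-! It suffices to show, for each column `(i₀, j₀)` of the lift of the perturbed blocks themselves,
that with overwhelming probability no combination of columns with coefficient `1` at `(i₀, j₀)` is
small; a union bound and a deterministic change of basis do the rest.

Let `H` be the at most `d` indices occurring in `j₀`, and freeze everything except the columns of
block `i₀` indexed by `H`. Symmetric tensors that annihilate all columns of the other blocks, and
vanish whenever one argument is a frozen column of block `i₀`, see only the lifted columns with
tuples in `H`; there are at most `d ^ d` of these, whatever `m` and `n` are. The two hypotheses on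
`s` and `m` leave so much dimension that `q`, of order `n`, disjoint batches of such tensors can be
chosen (`dimension_count`, `exists_seq_isSymmTensor`). Each tensor is normalized to have a
coefficient `1` of maximal size, and every later tensor vanishes on all coordinates used by that
pivot.

A batch has as many forms as there are surviving columns. By Cramer's rule, near dependence makes
the determinant of their values small (`abs_det_evalMatrix_le`), simultaneously in all batches. One
batch has a small determinant only with small probability: the determinant is a polynomial of
bounded degree in boundedly many pivot entries, polarization and the triangular structure produce a
bounded choice of these entries at which it is not small (`exists_det_evalMatrix_ge`), and a
univariate root estimate is applied one entry at a time (`lmarginal_sublevel_le`). Later batches do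
not involve the pivot entries of earlier ones, so the bounds multiply (`measure_pi_biInter_le`),
giving a probability exponentially small in `n`.

For the passage to orthonormal bases (`le_leastSingularValue_blockLift`), the coefficients are first
bounded with respect to the perturbed blocks. This bounds the contribution of each block separately,
and orthonormality then recovers the original coefficients, with no control on the conditioning of
the change of basis. -/

/-! ### Small values of univariate polynomials -/

/-- `φ` is given by a real polynomial of degree at most `k`. -/
def IsPolyOfDegreeLE (φ : ℝ → ℝ) (k : ℕ) : Prop :=
  ∃ p : Polynomial ℝ, p.natDegree ≤ k ∧ ∀ t, φ t = p.eval t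

theorem abs_eval_eq_prod_roots (p : Polynomial ℝ) (t : ℝ) :
    |p.eval t| = |p.leadingCoeff| *
      ((p.map (algebraMap ℝ ℂ)).roots.map fun z => ‖(t : ℂ) - z‖).prod := by
  have hs : (p.map (algebraMap ℝ ℂ)).Splits := IsAlgClosed.splits _
  have h1 : (p.map (algebraMap ℝ ℂ)).eval (t : ℂ) = ((p.eval t : ℝ) : ℂ) := by
    rw [Polynomial.eval_map_algebraMap]
    simpa using Polynomial.aeval_algebraMap_apply ℂ t p
  have h2 := congrArg norm (hs.eval_eq_prod_roots (t : ℂ))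
  rw [h1, Complex.norm_real, Real.norm_eq_abs] at h2
  rw [h2, norm_mul, Polynomial.leadingCoeff_map]
  congr 1
  · simp
  · have := map_multiset_prod (normHom : ℂ →*₀ ℝ) ((p.map (algebraMap ℝ ℂ)).roots.map fun z => (t : ℂ) - z)
    rw [Multiset.map_map] at this
    exact this

/-- Factor over `ℂ` and take for `Z` the real parts of the roots. Moving from `v` to `t` shrinks the
distance to a root by a factor of at worst `μ / (2 * W)`: a root within `2 * W` of `v` is still at
distance more than `μ` from `t`, and the distance to a farther root is at most halved. -/
theorem IsPolyOfDegreeLE.exists_finset_le_abs {φ : ℝ → ℝ} {k : ℕ} (hφ : IsPolyOfDegreeLE φ k)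
    {v W μ κ : ℝ} (hμ : 0 < μ) (hμW : μ ≤ W) (hv : κ ≤ |φ v|) :
    ∃ Z : Finset ℝ, Z.card ≤ k ∧ ∀ t, |t - v| ≤ W → (∀ z ∈ Z, μ < |t - z|) →
      κ * (μ / (2 * W)) ^ k ≤ |φ t| := by
  obtain ⟨p, hp, hφp⟩ := hφ
  set R := (p.map (algebraMap ℝ ℂ)).roots with hR
  have hRcard : Multiset.card R ≤ k :=
    ((Polynomial.card_roots' _).trans Polynomial.natDegree_map_le).trans hp
  have hW : 0 < W := hμ.trans_le hμW
  set r := μ / (2 * W) with hr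
  have hr0 : 0 < r := by positivity
  have hr1 : r ≤ 1 / 2 := by
    rw [hr, div_le_div_iff₀ (by positivity) (by norm_num)]; linarith
  refine ⟨(R.map Complex.re).toFinset, ?_, ?_⟩
  · exact (Multiset.toFinset_card_le _).trans (by simpa using hRcard)
  · intro t htv ht
    have key : ∀ z ∈ R, r * ‖(v : ℂ) - z‖ ≤ ‖(t : ℂ) - z‖ := by
      intro z hz
      have h1 : μ < ‖(t : ℂ) - z‖ := by
        have h2 := ht z.re (by simpa using ⟨z, hz, rfl⟩)
        have h3 : |((t : ℂ) - z).re| ≤ ‖(t : ℂ) - z‖ := Complex.abs_re_le_norm _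
        simp only [Complex.sub_re, Complex.ofReal_re] at h3
        exact h2.trans_le h3
      have htri : ‖(v : ℂ) - z‖ ≤ W + ‖(t : ℂ) - z‖ := by
        have h4 : ‖(v : ℂ) - t‖ ≤ W := by
          rw [← Complex.ofReal_sub, Complex.norm_real, Real.norm_eq_abs, abs_sub_comm]
          exact htv
        calc ‖(v : ℂ) - z‖ = ‖((v : ℂ) - t) + (t - z)‖ := by ring_nf
          _ ≤ _ := (norm_add_le _ _).trans (by linarith)
      rcases le_total ‖(v : ℂ) - z‖ (2 * W) with h | h
      · calc r * ‖(v : ℂ) - z‖ ≤ r * (2 * W) := by gcongr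
          _ = μ := by rw [hr]; field_simp
          _ ≤ _ := h1.le
      · have : r * ‖(v : ℂ) - z‖ ≤ 1 / 2 * ‖(v : ℂ) - z‖ := by gcongr
        linarith
    have hprod : (R.map fun z => r * ‖(v : ℂ) - z‖).prod ≤ (R.map fun z => ‖(t : ℂ) - z‖).prod :=
      Multiset.prod_map_le_prod_map₀ _ _ (fun z _ => by positivity) key
    rw [Multiset.prod_map_mul, Multiset.map_const', Multiset.prod_replicate] at hprod
    have hpow : r ^ k ≤ r ^ Multiset.card R :=
      pow_le_pow_of_le_one hr0.le (by linarith) hRcard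
    have hPv : 0 ≤ (R.map fun z => ‖(v : ℂ) - z‖).prod :=
      Multiset.prod_nonneg (by simp only [Multiset.mem_map]; rintro a ⟨z, -, rfl⟩; positivity)
    rw [hφp, abs_eval_eq_prod_roots] at hv ⊢
    calc κ * r ^ k ≤ |p.leadingCoeff| * (R.map fun z => ‖(v : ℂ) - z‖).prod * r ^ k := by gcongr
      _ ≤ |p.leadingCoeff| * (R.map fun z => ‖(v : ℂ) - z‖).prod * r ^ Multiset.card R := by
          gcongr
      _ = |p.leadingCoeff| * (r ^ Multiset.card R * (R.map fun z => ‖(v : ℂ) - z‖).prod) := by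
          ring
      _ ≤ _ := by gcongr

theorem IsPolyOfDegreeLE.measure_sublevel_le {φ : ℝ → ℝ} {k : ℕ} (hφ : IsPolyOfDegreeLE φ k)
    (ν : Measure ℝ) {v W μ κ : ℝ} {p₁ : ENNReal} (hp₁ : ∀ z, ν (Set.Icc (z - μ) (z + μ)) ≤ p₁)
    (hμ : 0 < μ) (hμW : μ ≤ W) (hvW : |v| ≤ W) (hv : κ ≤ |φ v|) :
    ν {t | |t| ≤ W ∧ |φ t| < κ * (μ / (4 * W)) ^ k} ≤ k * p₁ := by
  obtain ⟨Z, hZ, h⟩ := hφ.exists_finset_le_abs (W := 2 * W) hμ (by linarith) hv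
  have hsub : {t | |t| ≤ W ∧ |φ t| < κ * (μ / (4 * W)) ^ k} ⊆
      ⋃ z ∈ Z, Set.Icc (z - μ) (z + μ) := by
    rintro t ⟨ht, ht2⟩
    by_contra hcon
    simp only [Set.mem_iUnion, Set.mem_Icc, not_exists, not_and, not_le] at hcon
    have h3 : |t - v| ≤ 2 * W := (abs_sub _ _).trans (by linarith)
    have h4 := h t h3 fun z hz => by
      by_contra hle
      rw [not_lt, abs_le] at hle
      have := hcon z hz (by linarith)
      linarith
    rw [show 2 * (2 * W) = 4 * W by ring] at h4
    linarith
  calc _ ≤ ν (⋃ z ∈ Z, Set.Icc (z - μ) (z + μ)) := measure_mono hsub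
    _ ≤ ∑ z ∈ Z, ν (Set.Icc (z - μ) (z + μ)) := measure_biUnion_finset_le _ _
    _ ≤ ∑ z ∈ Z, p₁ := Finset.sum_le_sum fun z _ => hp₁ z
    _ = Z.card * p₁ := by simp
    _ ≤ _ := by gcongr

/-! ### Resampling coordinates of a product measure -/

section Marginals

variable {ι : Type*} [DecidableEq ι] {ν : Measure ℝ} [IsProbabilityMeasure ν]

theorem lmarginal_indicator_le_one (S : Finset ι) (E : Set (ι → ℝ)) (x : ι → ℝ) :
    (∫⋯∫⁻_S, E.indicator 1 ∂(fun _ => ν)) x ≤ 1 := by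
  refine (lmarginal_mono (g := fun _ => 1) (Set.indicator_le_self' (by simp)) x).trans ?_
  simp [lmarginal]

/-- A function that is polynomial in each coordinate, and not small at some point that differs
from `x` only in the coordinates `S`, is rarely small when these coordinates are resampled. -/
theorem lmarginal_sublevel_le {k : ℕ} {W μ : ℝ} {p₁ : ENNReal}
    (hp₁ : ∀ z, ν (Set.Icc (z - μ) (z + μ)) ≤ p₁) (hμ : 0 < μ) (hμW : μ ≤ W)
    {φ : (ι → ℝ) → ℝ} (hφ : Measurable φ)
    (hpoly : ∀ x i, IsPolyOfDegreeLE (fun t => φ (Function.update x i t)) k) (S : Finset ι) :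
    ∀ (κ : ℝ) (x x' : ι → ℝ), (∀ i ∉ S, x' i = x i) → (∀ i ∈ S, |x' i| ≤ W) →
      κ ≤ |φ x'| →
      (∫⋯∫⁻_S, Set.indicator {z | (∀ i ∈ S, |z i| ≤ W) ∧
        |φ z| < κ * (μ / (4 * W)) ^ (k * S.card)} 1 ∂(fun _ => ν)) x ≤ S.card * (k * p₁) := by
  have hmeas : ∀ (S : Finset ι) (a : ℝ),
      MeasurableSet {z : ι → ℝ | (∀ i ∈ S, |z i| ≤ W) ∧ |φ z| < a} := by
    intro S a
    refine MeasurableSet.inter ?_ (measurableSet_lt (f := fun z => |φ z|) (by fun_prop) measurable_const)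
    have : {z : ι → ℝ | ∀ i ∈ S, |z i| ≤ W} = ⋂ i ∈ S, {z : ι → ℝ | |z i| ≤ W} := by
      ext; simp
    change MeasurableSet {z : ι → ℝ | ∀ i ∈ S, |z i| ≤ W}
    rw [this]
    exact Finset.measurableSet_biInter _ fun i _ =>
      measurableSet_le (by fun_prop) measurable_const
  induction S using Finset.induction with
  | empty =>
    intro κ x x' hxx _ hφx
    have : x' = x := funext fun i => hxx i (by simp)
    subst this
    simp [Set.indicator, not_lt.2 hφx]
  | insert i S hi ih =>
    intro κ x x' hxx hW' hφx
    have hWpos : 0 < W := hμ.trans_le hμW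
    set r := μ / (4 * W) with hr
    have hr0 : 0 < r := by positivity
    -- The values of coordinate `i` that spoil the witness. For any other value in the box, `x'`
    -- updated at `i` is a witness for the remaining coordinates, with `κ` reduced by the factor `r
    -- ^ k`.
    set G : Set ℝ := {t | |t| ≤ W ∧ |φ (Function.update x' i t)| < κ * r ^ k} with hG
    have hνG : ν G ≤ k * p₁ :=
      (hpoly x' i).measure_sublevel_le ν hp₁ hμ hμW (hW' i (by simp)) (by simpa using hφx)
    rw [lmarginal_insert _ (measurable_one.indicator (hmeas _ _)) hi]
    calc _ ≤ ∫⁻ t, (G.indicator 1 t + S.card * (k * p₁)) ∂ν := by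
          refine lintegral_mono fun t => ?_
          by_cases ht : t ∈ G
          · rw [Set.indicator_of_mem ht]
            exact (lmarginal_indicator_le_one _ _ _).trans (by simp)
          · rw [Set.indicator_of_notMem ht, zero_add]
            by_cases htW : |t| ≤ W
            · have hge : κ * r ^ k ≤ |φ (Function.update x' i t)| := by
                by_contra hlt
                exact ht ⟨htW, not_le.1 hlt⟩
              refine le_trans (lmarginal_mono ?_ _) (ih (κ * r ^ k) (Function.update x i t)
                (Function.update x' i t) ?_ ?_ hge)
              · refine Set.indicator_le_indicator_of_subset ?_ (by simp)
                rintro z ⟨hz, hz2⟩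
                refine ⟨fun j hj => hz j (by simp [hj]), hz2.trans_eq ?_⟩
                rw [Finset.card_insert_of_notMem hi]
                ring
              · intro j hj
                rcases eq_or_ne j i with rfl | hji
                · simp
                · simp [hji, hxx j (by simp [hji, hj])]
              · intro j hj
                have hji : j ≠ i := fun h => hi (h ▸ hj)
                simpa [hji] using hW' j (by simp [hj])
            · refine le_of_eq_of_le ?_ zero_le
              unfold lmarginal
              refine (lintegral_congr fun y => ?_).trans lintegral_zero
              refine Set.indicator_of_notMem ?_ _
              rintro ⟨h1, -⟩
              apply htW
              simpa [Function.updateFinset, hi] using h1 i (by simp)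
      _ = (∫⁻ t, G.indicator 1 t ∂ν) + S.card * (k * p₁) := by
          rw [lintegral_add_right _ measurable_const]; simp
      _ ≤ k * p₁ + S.card * (k * p₁) := by
          gcongr
          exact (lintegral_indicator_one_le _).trans hνG
      _ = _ := by
          rw [Finset.card_insert_of_notMem hi]; push_cast; ring

variable [Fintype ι]

/-- Since `F` does not depend on the coordinates in `S`, its indicator factors out of the marginal
over `S`. -/
theorem measure_pi_inter_le {S : Finset ι} {E F : Set (ι → ℝ)} {p : ENNReal}
    (hE : MeasurableSet E) (hF : MeasurableSet F)
    (hp : ∀ x, (∫⋯∫⁻_S, E.indicator 1 ∂(fun _ => ν)) x ≤ p)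
    (hind : ∀ z z', (∀ i ∉ S, z i = z' i) → z ∈ F → z' ∈ F) :
    Measure.pi (fun _ : ι => ν) (E ∩ F) ≤ p * Measure.pi (fun _ : ι => ν) F := by
  have h := lintegral_le_of_lmarginal_le (μ := fun _ : ι => ν) S
    (f := (E ∩ F).indicator 1) (g := fun x => p * F.indicator 1 x)
    (measurable_one.indicator (hE.inter hF))
    (measurable_const.mul (measurable_one.indicator hF)) ?_
  · rwa [lintegral_indicator_one (hE.inter hF),
      lintegral_const_mul _ (measurable_one.indicator hF), lintegral_indicator_one hF] at h
  · intro x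
    by_cases hx : x ∈ F
    · have h1 : (∫⋯∫⁻_S, (fun x => p * F.indicator 1 x) ∂(fun _ => ν)) x = p := by
        unfold lmarginal
        rw [lintegral_congr (g := fun _ => p)]
        · simp
        · intro y
          have := hind x (Function.updateFinset x S y)
            (fun i hi => by simp [Function.updateFinset, hi]) hx
          simp [Set.indicator_of_mem this]
      rw [h1]
      refine le_trans (lmarginal_mono ?_ x) (hp x)
      exact Set.indicator_le_indicator_of_subset Set.inter_subset_left (by simp)
    · refine le_of_eq_of_le ?_ zero_le
      unfold lmarginal
      refine (lintegral_congr fun y => ?_).trans lintegral_zero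
      refine Set.indicator_of_notMem (fun hy => hx ?_) _
      exact hind _ x (fun i hi => by simp [Function.updateFinset, hi]) hy.2

/-- No independence is needed, only a one-sided order: the later events ignore the coordinates `S
0`, so resampling these peels off `E 0` with a factor `p`, and induction treats the rest. -/
theorem measure_pi_biInter_le (p : ENNReal) (q : ℕ) :
    ∀ (S : ℕ → Finset ι) (E : ℕ → Set (ι → ℝ)), (∀ b < q, MeasurableSet (E b)) →
    (∀ b < q, ∀ x, (∫⋯∫⁻_(S b), (E b).indicator 1 ∂(fun _ => ν)) x ≤ p) →
    (∀ b b', b < b' → b' < q → ∀ z z', (∀ i ∉ S b, z i = z' i) → z ∈ E b' → z' ∈ E b') →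
    Measure.pi (fun _ : ι => ν) {z | ∀ b < q, z ∈ E b} ≤ p ^ q := by
  induction q with
  | zero => intros; simp
  | succ q ih =>
    intro S E hE hp hind
    have hmF : MeasurableSet {z | ∀ b < q, z ∈ E (b + 1)} := by
      have : {z | ∀ b < q, z ∈ E (b + 1)} = ⋂ b ∈ Finset.range q, E (b + 1) := by ext; simp
      rw [this]
      exact Finset.measurableSet_biInter _ fun b hb => hE _ (by simpa using hb)
    have h1 := ih (fun b => S (b + 1)) (fun b => E (b + 1)) (fun b hb => hE _ (by omega))
      (fun b hb => hp _ (by omega)) (fun b b' hb hb' => hind _ _ (by omega) (by omega))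
    have h2 : {z | ∀ b < q + 1, z ∈ E b} = E 0 ∩ {z | ∀ b < q, z ∈ E (b + 1)} := by
      ext z
      constructor
      · intro h
        exact ⟨h 0 (by omega), fun b hb => h _ (by omega)⟩
      · rintro ⟨h0, h⟩ (_ | b) hb
        · exact h0
        · exact h b (by omega)
    rw [h2, pow_succ']
    refine (measure_pi_inter_le (S := S 0) (hE 0 (by omega)) hmF (hp 0 (by omega)) ?_).trans
      (by gcongr)
    intro z z' hz h b hb
    exact hind 0 (b + 1) (by omega) (by omega) z z' hz (h b hb)

theorem lmarginal_indicator_eq_measure {S : Finset ι} {F : Set (ι → ℝ)} (hF : MeasurableSet F)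
    (hind : ∀ z z', (∀ i ∈ S, z i = z' i) → z ∈ F → z' ∈ F) (x : ι → ℝ) :
    (∫⋯∫⁻_S, F.indicator 1 ∂(fun _ => ν)) x = Measure.pi (fun _ : ι => ν) F := by
  have h := lintegral_eq_of_lmarginal_eq (μ := fun _ : ι => ν) S
    (f := F.indicator 1) (g := fun _ => (∫⋯∫⁻_S, F.indicator 1 ∂(fun _ => ν)) x)
    (measurable_one.indicator hF) measurable_const ?_
  · rw [lintegral_indicator_one hF] at h
    rw [h]; simp
  · ext x'
    have : (∫⋯∫⁻_S, (fun _ => (∫⋯∫⁻_S, F.indicator 1 ∂(fun _ => ν)) x) ∂(fun _ => ν)) x' =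
        (∫⋯∫⁻_S, F.indicator 1 ∂(fun _ => ν)) x := by
      simp [lmarginal]
    rw [this]
    unfold lmarginal
    refine lintegral_congr fun y => ?_
    have hiff : Function.updateFinset x' S y ∈ F ↔ Function.updateFinset x S y ∈ F :=
      ⟨hind _ _ fun i hi => by simp [Function.updateFinset, hi],
        hind _ _ fun i hi => by simp [Function.updateFinset, hi]⟩
    by_cases h : Function.updateFinset x S y ∈ F
    · rw [Set.indicator_of_mem h, Set.indicator_of_mem (hiff.2 h)]; rfl
    · rw [Set.indicator_of_notMem h, Set.indicator_of_notMem (fun h' => h (hiff.1 h'))]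

/-- If, whatever the coordinates outside `S` are, the set `E` is covered by a set that depends on
the coordinates in `S` only and has measure at most `p`, then `E` has measure at most `p`. -/
theorem measure_pi_le_of_forall_section {S : Finset ι} {E : Set (ι → ℝ)} {p : ENNReal}
    (hE : MeasurableSet E)
    (h : ∀ x : ι → ℝ, ∃ F, MeasurableSet F ∧ (∀ z z', (∀ i ∈ S, z i = z' i) → z ∈ F → z' ∈ F) ∧
      Measure.pi (fun _ : ι => ν) F ≤ p ∧ ∀ z ∈ E, (∀ i ∉ S, z i = x i) → z ∈ F) :
    Measure.pi (fun _ : ι => ν) E ≤ p := by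
  have h1 := lintegral_le_of_lmarginal_le (μ := fun _ : ι => ν) S
    (f := E.indicator 1) (g := fun _ => p) (measurable_one.indicator hE) measurable_const ?_
  · rw [lintegral_indicator_one hE] at h1
    simpa using h1
  · intro x
    obtain ⟨F, hF, hind, hpF, hEF⟩ := h x
    have h2 : (∫⋯∫⁻_S, (fun _ => p) ∂(fun _ : ι => ν)) x = p := by simp [lmarginal]
    rw [h2]
    refine le_trans ?_ ((lmarginal_indicator_eq_measure hF hind x).trans_le hpF)
    unfold lmarginal
    refine lintegral_mono fun y => ?_
    by_cases hy : Function.updateFinset x S y ∈ E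
    · rw [Set.indicator_of_mem hy, Set.indicator_of_mem
        (hEF _ hy fun i hi => by simp [Function.updateFinset, hi])]
    · rw [Set.indicator_of_notMem hy]; exact zero_le

end Marginals

/-! ### Symmetric tensors under linear conditions -/

/-- The value of the multilinear form with coefficient tensor `f` at the vectors `x`. -/
def tensorEval {d n : ℕ} (f : (Fin d → Fin n) → ℝ) (x : Fin d → Fin n → ℝ) : ℝ :=
  ∑ r, f r * ∏ b, x b (r b)

/-- Symmetric tensors, given by their coefficients. -/
def IsSymmTensor {d n : ℕ} (f : (Fin d → Fin n) → ℝ) : Prop :=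
  ∀ (σ : Equiv.Perm (Fin d)) (r : Fin d → Fin n), f (r ∘ σ) = f r

theorem tensorEval_comp_perm {d n : ℕ} {f : (Fin d → Fin n) → ℝ} (hf : IsSymmTensor f)
    (x : Fin d → Fin n → ℝ) (σ : Equiv.Perm (Fin d)) : tensorEval f (x ∘ σ) = tensorEval f x := by
  unfold tensorEval
  refine Fintype.sum_equiv (σ.arrowCongr (Equiv.refl (Fin n))) _ _ fun r => ?_
  have h1 : (σ.arrowCongr (Equiv.refl (Fin n))) r = r ∘ σ.symm := rfl
  rw [h1, hf σ.symm r, ← Equiv.prod_comp σ (fun b => x b ((r ∘ σ.symm) b))]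
  simp

/-- All `d!` terms of the symmetrization pair equally with a symmetric tensor. Linear functionals on
lifted columns thus become values of multilinear forms at the original columns. -/
theorem sum_mul_symKronPow {d n m : ℕ} {f : (Fin d → Fin n) → ℝ} (hf : IsSymmTensor f)
    (U : Matrix (Fin n) (Fin m) ℝ) (k : NondecTuple d m) :
    ∑ r, f r * symKronPow d U r k = tensorEval f fun b t => U t (k.1 b) := by
  have h : ∀ π : Equiv.Perm (Fin d), ∑ r, f r * ∏ j, U (r j) (k.1 (π j)) =
      tensorEval f fun b t => U t (k.1 b) := fun π =>
    tensorEval_comp_perm hf (fun b t => U t (k.1 b)) π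
  simp only [symKronPow, Matrix.of_apply]
  calc _ = ∑ r, ∑ π : Equiv.Perm (Fin d),
        1 / (d.factorial : ℝ) * (f r * ∏ j, U (r j) (k.1 (π j))) := by
        refine Finset.sum_congr rfl fun r _ => ?_
        rw [Finset.mul_sum, Finset.mul_sum]
        exact Finset.sum_congr rfl fun π _ => by ring
    _ = ∑ π : Equiv.Perm (Fin d), 1 / (d.factorial : ℝ) * tensorEval f fun b t => U t (k.1 b) := by
        rw [Finset.sum_comm]
        refine Finset.sum_congr rfl fun π _ => ?_
        rw [← Finset.mul_sum, h π]
    _ = _ := by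
        rw [Finset.sum_const, Finset.card_univ, Fintype.card_perm, Fintype.card_fin, nsmul_eq_mul]
        field_simp

/-- The nondecreasing rearrangement of a tuple. -/
def sortTuple {d n : ℕ} (r : Fin d → Fin n) : NondecTuple d n :=
  ⟨r ∘ Tuple.sort r, fun _ _ h => Tuple.monotone_sort r h⟩

theorem sortTuple_comp_perm {d n : ℕ} (r : Fin d → Fin n) (σ : Equiv.Perm (Fin d)) :
    sortTuple (r ∘ σ) = sortTuple r :=
  Subtype.ext Tuple.comp_perm_comp_sort_eq_comp_sort

theorem sortTuple_val {d n : ℕ} (k : NondecTuple d n) : sortTuple k.1 = k := by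
  apply Subtype.ext
  change k.1 ∘ Tuple.sort k.1 = k.1
  rw [Tuple.sort_eq_refl_iff_monotone.2 fun a b h => k.2 a b h]
  rfl

theorem NondecTuple.eq_of_comp_perm {d n : ℕ} {k k' : NondecTuple d n} {σ : Equiv.Perm (Fin d)}
    (h : k.1 ∘ σ = k'.1) : k = k' := by
  rw [← sortTuple_val k, ← sortTuple_val k', ← h, sortTuple_comp_perm]

/-- Contraction of the first argument with a vector. -/
def contract {e n : ℕ} (f : (Fin (e + 1) → Fin n) → ℝ) (y : Fin n → ℝ) (r : Fin e → Fin n) : ℝ :=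
  ∑ t, y t * f (Fin.cons t r)

theorem IsSymmTensor.contract {e n : ℕ} {f : (Fin (e + 1) → Fin n) → ℝ} (hf : IsSymmTensor f)
    (y : Fin n → ℝ) : IsSymmTensor (contract f y) := by
  intro σ r
  refine Finset.sum_congr rfl fun t _ => ?_
  rw [← hf (Equiv.Perm.decomposeFin.symm (0, σ)) (Fin.cons t r)]
  congr 2
  funext i
  refine Fin.cases ?_ (fun j => ?_) i
  · simp
  · simp

theorem tensorEval_eq_sum_contract {e n : ℕ} (f : (Fin (e + 1) → Fin n) → ℝ)
    (x : Fin (e + 1) → Fin n → ℝ) :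
    tensorEval f x = ∑ r, contract f (x 0) r * ∏ b, x (Fin.succ b) (r b) := by
  unfold tensorEval contract
  rw [← (Fin.consEquiv fun _ => Fin n).sum_comp, Fintype.sum_prod_type, Finset.sum_comm]
  refine Finset.sum_congr rfl fun r _ => ?_
  rw [Finset.sum_mul]
  refine Finset.sum_congr rfl fun t _ => ?_
  simp [Fin.consEquiv, Fin.prod_univ_succ]
  ring

/-- Symmetry moves the argument `y` to the first slot, and the contraction is again symmetric. Hence
vanishing on a vector in every slot costs only one condition per nondecreasing `e`-tuple. -/
theorem tensorEval_eq_zero_of_contract {e n : ℕ} {f : (Fin (e + 1) → Fin n) → ℝ}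
    (hf : IsSymmTensor f) {y : Fin n → ℝ} (h : ∀ k : NondecTuple e n, contract f y k.1 = 0)
    {x : Fin (e + 1) → Fin n → ℝ} {b : Fin (e + 1)} (hb : x b = y) : tensorEval f x = 0 := by
  have h0 : ∀ r, contract f y r = 0 := fun r => by
    rw [← hf.contract y (Tuple.sort r) r]
    exact h (sortTuple r)
  rw [← tensorEval_comp_perm hf x (Equiv.swap 0 b), tensorEval_eq_sum_contract]
  simp [hb, h0]

/-- A symmetric tensor that satisfies few linear conditions, normalized so that its largest
coefficient is `1`. -/
theorem exists_isSymmTensor {e n : ℕ} {ι₁ ι₂ : Type*} [Fintype ι₁] [Fintype ι₂]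
    (w : ι₁ → (Fin (e + 1) → Fin n) → ℝ) (y : ι₂ → Fin n → ℝ)
    (hcard : Fintype.card ι₁ + Fintype.card ι₂ * Fintype.card (NondecTuple e n) <
      Fintype.card (NondecTuple (e + 1) n)) :
    ∃ (f : (Fin (e + 1) → Fin n) → ℝ) (τ : Fin (e + 1) → Fin n), IsSymmTensor f ∧
      (∀ r, |f r| ≤ 1) ∧ f τ = 1 ∧ (∀ i, ∑ r, f r * w i r = 0) ∧
      ∀ i x b, x b = y i → tensorEval f x = 0 := by
  classical
  -- A symmetric tensor is encoded by its coefficients at nondecreasing tuples, and `T` collects all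
  -- the conditions; the count `hcard` forces a kernel.
  let T : (NondecTuple (e + 1) n → ℝ) →ₗ[ℝ] (ι₁ ⊕ (ι₂ × NondecTuple e n) → ℝ) :=
    { toFun := fun c => Sum.elim (fun i => ∑ r, c (sortTuple r) * w i r)
        (fun p => contract (fun r => c (sortTuple r)) (y p.1) p.2.1)
      map_add' := fun c c' => by
        ext (i | p)
        · simp [add_mul, Finset.sum_add_distrib]
        · simp [contract, mul_add, Finset.sum_add_distrib]
      map_smul' := fun a c => by
        ext (i | p)
        · simp [Finset.mul_sum, mul_assoc]
        · simp [contract, Finset.mul_sum, mul_left_comm] }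
  have hker : LinearMap.ker T ≠ ⊥ := by
    apply LinearMap.ker_ne_bot_of_finrank_lt
    simpa using hcard
  obtain ⟨c, hc, hc0⟩ := Submodule.exists_mem_ne_zero_of_ne_bot hker
  have hT : T c = 0 := hc
  obtain ⟨k, hk⟩ : ∃ k, c k ≠ 0 := by
    by_contra hcon
    push Not at hcon
    exact hc0 (funext hcon)
  set g : (Fin (e + 1) → Fin n) → ℝ := fun r => c (sortTuple r) with hg
  have hgk : g k.1 ≠ 0 := by simpa [hg, sortTuple_val] using hk
  obtain ⟨τ, -, hτ⟩ := Finset.exists_max_image Finset.univ (fun r => |g r|) ⟨k.1, Finset.mem_univ _⟩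
  have hτ0 : g τ ≠ 0 := by
    have h1 := hτ k.1 (Finset.mem_univ _)
    have h2 := abs_pos.2 hgk
    exact abs_pos.1 (h2.trans_le h1)
  have hsymm : IsSymmTensor g := fun σ r => by simp only [hg, sortTuple_comp_perm]
  refine ⟨fun r => (g τ)⁻¹ * g r, τ, fun σ r => congrArg _ (hsymm σ r), fun r => ?_, ?_, fun i => ?_,
    fun i x b hb => ?_⟩
  · rw [abs_mul, abs_inv, inv_mul_le_one₀ (abs_pos.2 hτ0)]
    exact hτ r (Finset.mem_univ _)
  · exact inv_mul_cancel₀ hτ0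
  · have := congrFun hT (Sum.inl i)
    simp only [mul_assoc, ← Finset.mul_sum]
    simp only [T, LinearMap.coe_mk, AddHom.coe_mk, Sum.elim_inl, Pi.zero_apply] at this
    rw [hg, this, mul_zero]
  · have h0 : tensorEval g x = 0 := tensorEval_eq_zero_of_contract hsymm (y := y i) (fun k => by
      have := congrFun hT (Sum.inr (i, k))
      simpa only [T, LinearMap.coe_mk, AddHom.coe_mk, Sum.elim_inr, Pi.zero_apply] using this) hb
    unfold tensorEval at h0 ⊢
    simp only [mul_assoc, ← Finset.mul_sum, h0, mul_zero]

/-! ### Polarization at a pivot -/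

/-- Polarization: an alternating sum over the subsets of a set of increments. -/
theorem sum_powerset_prod_add {α : Type*} [Fintype α] [DecidableEq α] (y : α → ℝ)
    (c : α → α → ℝ) :
    ∑ s : Finset α, (-1 : ℝ) ^ (sᶜ).card * ∏ b, (y b + ∑ a ∈ s, c a b) =
      ∑ σ : Equiv.Perm α, ∏ b, c (σ b) b := by
  -- In the expansion, `g b = none` selects `y b` from factor `b`, and `g b = some a` selects `c a
  -- b`.
  have hexp : ∀ s : Finset α, ∏ b, (y b + ∑ a ∈ s, c a b) =
      ∑ g : α → Option α, (if ∀ a, (∃ b, g b = some a) → a ∈ s then (1 : ℝ) else 0) *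
        ∏ b, (g b).elim (y b) (fun a => c a b) := by
    intro s
    have h1 : ∀ b, y b + ∑ a ∈ s, c a b =
        ∑ o : Option α, o.elim (y b) (fun a => if a ∈ s then c a b else 0) := by
      intro b
      rw [Fintype.sum_option]
      simp [Finset.sum_ite_mem]
    simp only [h1]
    rw [Finset.prod_univ_sum, Fintype.piFinset_univ]
    refine Finset.sum_congr rfl fun g _ => ?_
    split_ifs with h
    · rw [one_mul]
      refine Finset.prod_congr rfl fun b _ => ?_
      rcases hgb : g b with _ | a
      · rfl
      · simp [h a ⟨b, hgb⟩]
    · push Not at h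
      obtain ⟨a, ⟨b, hb⟩, ha⟩ := h
      rw [zero_mul]
      exact Finset.prod_eq_zero (i := b) (Finset.mem_univ b) (by simp [hb, ha])
  -- The signed sum over `s` is a product over `a` with factor `1 - 1 = 0` at each `a` missed by
  -- `g`. Only those `g` that hit every `a` survive, and by cardinality these are permutations.
  have hsign : ∀ g : α → Option α, ∑ s : Finset α, (-1 : ℝ) ^ (sᶜ).card *
      (if ∀ a, (∃ b, g b = some a) → a ∈ s then (1 : ℝ) else 0) =
        if ∀ a, ∃ b, g b = some a then 1 else 0 := by
    intro g
    have h2 := Finset.prod_add (fun _ : α => (1 : ℝ))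
      (fun a => if ∃ b, g b = some a then 0 else -1) Finset.univ
    rw [Finset.powerset_univ] at h2
    have h3 : ∀ s : Finset α, (-1 : ℝ) ^ (sᶜ).card *
        (if ∀ a, (∃ b, g b = some a) → a ∈ s then (1 : ℝ) else 0) =
        (∏ a ∈ s, (1 : ℝ)) * ∏ a ∈ Finset.univ \ s, (if ∃ b, g b = some a then 0 else -1) := by
      intro s
      rw [Finset.prod_const_one, one_mul, ← Finset.compl_eq_univ_sdiff]
      split_ifs with h
      · rw [mul_one, ← Finset.prod_const]
        refine Finset.prod_congr rfl fun a ha => ?_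
        rw [if_neg fun h' => (Finset.mem_compl.1 ha) (h a h')]
      · push Not at h
        obtain ⟨a, hab, ha⟩ := h
        rw [mul_zero]
        exact (Finset.prod_eq_zero (f := fun a => if ∃ b, g b = some a then (0 : ℝ) else -1)
          (Finset.mem_compl.2 ha) (if_pos hab)).symm
    rw [Finset.sum_congr rfl fun s _ => h3 s, ← h2]
    split_ifs with h
    · exact Finset.prod_eq_one fun a _ => by simp [h a]
    · push Not at h
      obtain ⟨a, ha⟩ := h
      refine Finset.prod_eq_zero (Finset.mem_univ a) ?_
      rw [if_neg (by push Not; exact ha)]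
      norm_num
  calc _ = ∑ g : α → Option α, (∑ s : Finset α, (-1 : ℝ) ^ (sᶜ).card *
        (if ∀ a, (∃ b, g b = some a) → a ∈ s then (1 : ℝ) else 0)) *
          ∏ b, (g b).elim (y b) (fun a => c a b) := by
        simp only [hexp, Finset.mul_sum, Finset.sum_mul]
        rw [Finset.sum_comm]
        simp only [mul_assoc]
    _ = ∑ g ∈ Finset.univ.filter fun g : α → Option α => ∀ a, ∃ b, g b = some a,
          ∏ b, (g b).elim (y b) (fun a => c a b) := by
        rw [Finset.sum_filter]
        refine Finset.sum_congr rfl fun g _ => ?_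
        rw [hsign]
        split_ifs <;> simp
    _ = _ := by
        symm
        refine Finset.sum_bij (fun σ _ => fun b => some (σ b)) ?_ ?_ ?_ ?_
        · intro σ _
          simp only [Finset.mem_filter, Finset.mem_univ, true_and]
          exact fun a => ⟨σ.symm a, by simp⟩
        · intro σ _ σ' _ h
          ext b
          simpa using congrFun h b
        · intro g hg
          simp only [Finset.mem_filter, Finset.mem_univ, true_and] at hg
          choose h hh using hg
          have hinj : Function.Injective h := fun a a' haa => by
            have := hh a
            rw [haa, hh a'] at this
            exact (Option.some.inj this).symm
          have hbij := Finite.injective_iff_bijective.1 hinj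
          refine ⟨(Equiv.ofBijective h hbij).symm, Finset.mem_univ _, ?_⟩
          funext b
          obtain ⟨a, rfl⟩ := hbij.2 b
          rw [hh a]
          congr 1
          exact (Equiv.ofBijective h hbij).symm_apply_apply a
        · intro σ _
          rfl

/-- The sum of the matrix units at the positions `(τ a, k a)`, `a ∈ s`. -/
def unitSum {d n m : ℕ} (τ : Fin d → Fin n) (k : Fin d → Fin m) (s : Finset (Fin d))
    (t : Fin n) (h : Fin m) : ℝ :=
  ∑ a ∈ s, if t = τ a ∧ h = k a then 1 else 0

/-- Polarization removes the dependence on `x` and leaves the coefficients `f (τ ∘ σ) = f τ = 1`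
over the `σ` with `k ∘ σ = k'`. Nondecreasing tuples that are rearrangements of each other coincide,
so what remains is the order of the stabilizer of `k`. -/
theorem sum_powerset_tensorEval {d n m : ℕ} {f : (Fin d → Fin n) → ℝ} (hf : IsSymmTensor f)
    {τ : Fin d → Fin n} (hτ : f τ = 1) (x : Fin n → Fin m → ℝ) (k k' : NondecTuple d m) :
    ∑ s : Finset (Fin d), (-1 : ℝ) ^ (sᶜ).card *
      tensorEval f (fun b t => x t (k'.1 b) + unitSum τ k.1 s t (k'.1 b)) =
    if k = k' then ((Finset.univ.filter fun σ : Equiv.Perm (Fin d) => k.1 ∘ σ = k.1).card : ℝ)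
      else 0 := by
  have h1 : ∑ s : Finset (Fin d), (-1 : ℝ) ^ (sᶜ).card *
      tensorEval f (fun b t => x t (k'.1 b) + unitSum τ k.1 s t (k'.1 b)) =
      ∑ r, f r * ∑ σ : Equiv.Perm (Fin d),
        ∏ b, (if r b = τ (σ b) ∧ k'.1 b = k.1 (σ b) then (1 : ℝ) else 0) := by
    simp only [tensorEval, unitSum, Finset.mul_sum]
    rw [Finset.sum_comm]
    refine Finset.sum_congr rfl fun r _ => ?_
    rw [← Finset.mul_sum, ← sum_powerset_prod_add (fun b => x (r b) (k'.1 b))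
      (fun a b => if r b = τ a ∧ k'.1 b = k.1 a then (1 : ℝ) else 0), Finset.mul_sum]
    exact Finset.sum_congr rfl fun s _ => by ring
  have h2 : ∀ σ : Equiv.Perm (Fin d), ∑ r, f r *
      ∏ b, (if r b = τ (σ b) ∧ k'.1 b = k.1 (σ b) then (1 : ℝ) else 0) =
      if k.1 ∘ σ = k'.1 then 1 else 0 := by
    intro σ
    rw [Finset.sum_eq_single (τ ∘ σ)]
    · rw [hf, hτ, one_mul, Finset.prod_boole]
      simp [funext_iff, eq_comm]
    · intro r _ hr
      obtain ⟨b, hb⟩ := Function.ne_iff.1 hr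
      rw [Finset.prod_eq_zero (Finset.mem_univ b), mul_zero]
      exact if_neg fun h => hb h.1
    · simp
  rw [h1]
  simp only [Finset.mul_sum]
  rw [Finset.sum_comm]
  simp only [h2]
  split_ifs with hkk
  · subst hkk
    rw [Finset.sum_boole]
  · refine Finset.sum_eq_zero fun σ _ => if_neg fun h => hkk (NondecTuple.eq_of_comp_perm h)

/-! ### Triangular systems of forms -/

section Determinant

variable {d n m : ℕ} {J : Type*}

/-- The values of the forms `F k` at the columns of `x` with indices `col k'`. -/
def evalMatrix (F : J → (Fin d → Fin n) → ℝ) (col : J → NondecTuple d m)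
    (x : Fin n → Fin m → ℝ) : Matrix J J ℝ :=
  Matrix.of fun k k' => tensorEval (F k) fun b t => x t ((col k').1 b)

theorem evalMatrix_apply (F : J → (Fin d → Fin n) → ℝ) (col : J → NondecTuple d m)
    (x : Fin n → Fin m → ℝ) (k k' : J) :
    evalMatrix F col x k k' = tensorEval (F k) fun b t => x t ((col k').1 b) := rfl

theorem tensorEval_congr {f : (Fin d → Fin n) → ℝ} {x x' : Fin d → Fin n → ℝ}
    (h : ∀ r, f r ≠ 0 → ∀ b, x b (r b) = x' b (r b)) : tensorEval f x = tensorEval f x' := by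
  refine Finset.sum_congr rfl fun r _ => ?_
  by_cases hr : f r = 0
  · simp [hr]
  · congr 1
    exact Finset.prod_congr rfl fun b _ => h r hr b

variable [Fintype J] [DecidableEq J]

/-- The signed sum of the `2 ^ d` candidate rows is `c` times the unit row `N k`, where `c ≥ 1` is
the order of a stabilizer. The determinant is linear in this row, so the candidates cannot all fall
below `2 ^ (-d)` times the original determinant. -/
theorem exists_det_updateRow_ge {f : (Fin d → Fin n) → ℝ} (hf : IsSymmTensor f)
    {τ : Fin d → Fin n} (hτ : f τ = 1) {col : J → NondecTuple d m} (hcol : Function.Injective col)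
    (N : Matrix J J ℝ) (k : J) (hN : N k = Pi.single k 1) (x : Fin n → Fin m → ℝ) :
    ∃ s : Finset (Fin d), (2 ^ d)⁻¹ * |N.det| ≤ |(N.updateRow k fun k' =>
      tensorEval f fun b t => x t ((col k').1 b) + unitSum τ (col k).1 s t ((col k').1 b)).det| := by
  set c : ℝ := ((Finset.univ.filter fun σ : Equiv.Perm (Fin d) =>
    (col k).1 ∘ σ = (col k).1).card : ℝ) with hc
  have hc1 : 1 ≤ c := by
    have : 0 < (Finset.univ.filter fun σ : Equiv.Perm (Fin d) =>
      (col k).1 ∘ σ = (col k).1).card := Finset.card_pos.2 ⟨1, by simp⟩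
    rw [hc, Nat.one_le_cast]
    exact this
  set D : Finset (Fin d) → ℝ := fun s => (N.updateRow k fun k' =>
      tensorEval f fun b t => x t ((col k').1 b) +
        unitSum τ (col k).1 s t ((col k').1 b)).det with hD
  have hsum : ∑ s : Finset (Fin d), (-1 : ℝ) ^ (sᶜ).card * D s = c * N.det := by
    let A : (J → ℝ) →ₗ[ℝ] ℝ := (Matrix.detRowAlternating : (J → ℝ) [⋀^J]→ₗ[ℝ] ℝ).toMultilinearMap.toLinearMap N k
    have hA : ∀ v, A v = (N.updateRow k v).det := fun v => rfl
    have h1 : ∀ s, (-1 : ℝ) ^ (sᶜ).card * D s = A ((-1 : ℝ) ^ (sᶜ).card • fun k' =>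
      tensorEval f fun b t => x t ((col k').1 b) +
        unitSum τ (col k).1 s t ((col k').1 b)) := fun s => by
      rw [map_smul, hA, smul_eq_mul]
    simp only [h1]
    rw [← map_sum]
    have h2 : (∑ s : Finset (Fin d), (-1 : ℝ) ^ (sᶜ).card • fun k' =>
        tensorEval f fun b t => x t ((col k').1 b) +
          unitSum τ (col k).1 s t ((col k').1 b)) = c • N k := by
      funext k'
      rw [Finset.sum_apply]
      simp only [Pi.smul_apply, smul_eq_mul]
      rw [sum_powerset_tensorEval hf hτ, hN]
      rcases eq_or_ne k k' with rfl | hkk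
      · simp [hc]
      · rw [if_neg fun h => hkk (hcol h), Pi.single_eq_of_ne hkk.symm, mul_zero]
    rw [h2, map_smul, hA, Matrix.updateRow_eq_self, smul_eq_mul]
  by_contra! hcon
  have h3 : |c * N.det| < |N.det| := by
    calc |c * N.det| ≤ ∑ s : Finset (Fin d), |D s| := by
          rw [← hsum]
          refine (Finset.abs_sum_le_sum_abs _ _).trans_eq ?_
          simp [abs_mul]
      _ < ∑ s : Finset (Fin d), (2 ^ d)⁻¹ * |N.det| :=
          Finset.sum_lt_sum_of_nonempty ⟨∅, Finset.mem_univ _⟩ fun s _ => hcon s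
      _ = |N.det| := by
          simp
  rw [abs_mul, abs_of_nonneg (by linarith)] at h3
  nlinarith [abs_nonneg N.det]

/-- Bounded changes of the entries at the positions `(τ k a, col k a)` make the determinant of a
triangular system of forms large. -/
theorem exists_det_evalMatrix_ge {F : J → (Fin d → Fin n) → ℝ} (hF : ∀ k, IsSymmTensor (F k))
    {τ : J → Fin d → Fin n} (hτ : ∀ k, F k (τ k) = 1) {col : J → NondecTuple d m}
    (hcol : Function.Injective col) {D : ℕ} (e : J ≃ Fin D)
    (hkill : ∀ k k', e k < e k' → ∀ r b a, r b = τ k a → F k' r = 0) (x : Fin n → Fin m → ℝ) :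
    ∃ x' : Fin n → Fin m → ℝ, (∀ t h, (∀ k a, t = τ k a → h ≠ (col k).1 a) → x' t h = x t h) ∧
      (∀ t h, |x' t h - x t h| ≤ d * D) ∧
      ((2 ^ d)⁻¹ : ℝ) ^ D ≤ |(evalMatrix F col x').det| := by
  -- Interpolation between the identity (`l = D`) and the evaluation matrix (`l = 0`). The true rows
  -- are installed from the last to the first, each at a cost of `2 ^ (-d)`.
  let R : ℕ → (Fin n → Fin m → ℝ) → Matrix J J ℝ := fun l x => Matrix.of fun k =>
    if (e k : ℕ) < l then Pi.single k 1 else evalMatrix F col x k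
  have hRlt : ∀ l x k, (e k : ℕ) < l → R l x k = Pi.single k 1 := fun l x k h => if_pos h
  have hRge : ∀ l x k, ¬ (e k : ℕ) < l → R l x k = evalMatrix F col x k := fun l x k h => if_neg h
  have key : ∀ j ≤ D, ∃ x' : Fin n → Fin m → ℝ,
      (∀ t h, (∀ k a, t = τ k a → h ≠ (col k).1 a) → x' t h = x t h) ∧
      (∀ t h, |x' t h - x t h| ≤ d * j) ∧ ((2 ^ d)⁻¹ : ℝ) ^ j ≤ |(R (D - j) x').det| := by
    intro j
    induction j with
    | zero =>
      intro _
      refine ⟨x, fun _ _ _ => rfl, by simp, ?_⟩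
      have : R (D - 0) x = 1 := by
        ext k k'
        simp [R, Matrix.one_apply, Pi.single_apply, eq_comm]
      rw [this]
      simp
    | succ j ih =>
      intro hj
      obtain ⟨x₁, h₁, h₂, h₃⟩ := ih (by omega)
      obtain ⟨k, hk⟩ : ∃ k, (e k : ℕ) = D - (j + 1) :=
        ⟨e.symm ⟨D - (j + 1), by omega⟩, by simp⟩
      have hNk : R (D - j) x₁ k = Pi.single k 1 := by
        exact hRlt _ _ _ (by omega)
      obtain ⟨s, hs⟩ := exists_det_updateRow_ge (hF k) (hτ k) hcol (R (D - j) x₁) k hNk x₁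
      refine ⟨fun t h => x₁ t h + unitSum (τ k) (col k).1 s t h, fun t h hth => ?_,
        fun t h => ?_, ?_⟩
      · simp only
        rw [h₁ t h hth, unitSum, Finset.sum_eq_zero, add_zero]
        exact fun a _ => if_neg fun h' => hth k a h'.1 h'.2
      · have hu : |unitSum (τ k) (col k).1 s t h| ≤ d := by
          unfold unitSum
          refine (Finset.abs_sum_le_sum_abs _ _).trans ?_
          calc _ ≤ ∑ a ∈ s, (1 : ℝ) := Finset.sum_le_sum fun a _ => by split_ifs <;> simp
            _ ≤ d := by
              simpa using (Nat.cast_le (α := ℝ)).2 (s.card_le_univ.trans_eq (Fintype.card_fin d))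
        calc _ = |(x₁ t h - x t h) + unitSum (τ k) (col k).1 s t h| := by ring_nf
          _ ≤ d * j + d := (abs_add_le _ _).trans (add_le_add (h₂ t h) hu)
          _ = _ := by push_cast; ring
      · have hR : R (D - (j + 1)) (fun t h => x₁ t h + unitSum (τ k) (col k).1 s t h) =
            (R (D - j) x₁).updateRow k fun k' => tensorEval (F k) fun b t =>
              x₁ t ((col k').1 b) + unitSum (τ k) (col k).1 s t ((col k').1 b) := by
          funext k₁
          rcases eq_or_ne k₁ k with hkk | hkk
          · subst k₁
            rw [Matrix.updateRow_self]
            exact hRge _ _ _ (by omega)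
          · rw [Matrix.updateRow_ne hkk]
            have hne : (e k₁ : ℕ) ≠ e k := fun h => hkk (e.injective (Fin.ext h))
            by_cases hlt : (e k₁ : ℕ) < D - (j + 1)
            · rw [hRlt _ _ _ hlt, hRlt _ _ _ (by omega)]
            · rw [hRge _ _ _ hlt, hRge _ _ _ (by omega)]
              funext k'
              simp only [evalMatrix_apply]
              -- The rows already installed belong to later forms, whose coefficients vanish at
              -- every tuple meeting `τ k`; the new increments do not affect them.
              refine tensorEval_congr fun r hr b => ?_
              simp only [unitSum]
              rw [Finset.sum_eq_zero, add_zero]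
              intro a _
              refine if_neg fun h => hr (hkill k k₁ ?_ r b a h.1)
              exact Fin.lt_def.2 (by omega)
        rw [hR]
        refine le_trans ?_ hs
        rw [pow_succ']
        gcongr
  have hR0 : ∀ x, R (D - D) x = evalMatrix F col x := fun x =>
    funext fun k => hRge _ _ _ (by omega)
  simpa only [hR0] using key D le_rfl

end Determinant

/-! ### Degrees in a single entry -/

namespace IsPolyOfDegreeLE

theorem const (a : ℝ) (k : ℕ) : IsPolyOfDegreeLE (fun _ => a) k :=
  ⟨Polynomial.C a, by simp, by simp⟩

theorem mul {φ ψ : ℝ → ℝ} {k l : ℕ} (hφ : IsPolyOfDegreeLE φ k) (hψ : IsPolyOfDegreeLE ψ l) :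
    IsPolyOfDegreeLE (fun t => φ t * ψ t) (k + l) := by
  obtain ⟨p, hp, h⟩ := hφ
  obtain ⟨q, hq, h'⟩ := hψ
  exact ⟨p * q, Polynomial.natDegree_mul_le.trans (add_le_add hp hq), by simp [h, h']⟩

theorem const_mul {φ : ℝ → ℝ} {k : ℕ} (a : ℝ) (hφ : IsPolyOfDegreeLE φ k) :
    IsPolyOfDegreeLE (fun t => a * φ t) k := by
  simpa using (const a 0).mul hφ

theorem sum {α : Type*} {s : Finset α} {φ : α → ℝ → ℝ} {k : ℕ}
    (h : ∀ a ∈ s, IsPolyOfDegreeLE (φ a) k) : IsPolyOfDegreeLE (fun t => ∑ a ∈ s, φ a t) k := by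
  choose! p hp hφ using h
  refine ⟨∑ a ∈ s, p a, Polynomial.natDegree_sum_le_of_forall_le _ _ hp, fun t => ?_⟩
  rw [Polynomial.eval_finsetSum]
  exact Finset.sum_congr rfl fun a ha => hφ a ha t

theorem prod {α : Type*} {s : Finset α} {φ : α → ℝ → ℝ} {k : ℕ}
    (h : ∀ a ∈ s, IsPolyOfDegreeLE (φ a) k) :
    IsPolyOfDegreeLE (fun t => ∏ a ∈ s, φ a t) (s.card * k) := by
  choose! p hp hφ using h
  refine ⟨∏ a ∈ s, p a, (Polynomial.natDegree_prod_le _ _).trans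
    ((Finset.sum_le_card_nsmul _ _ _ hp).trans_eq (smul_eq_mul _ _)), fun t => ?_⟩
  rw [Polynomial.eval_prod]
  exact Finset.prod_congr rfl fun a ha => hφ a ha t

theorem det {J : Type*} [Fintype J] [DecidableEq J] {M : ℝ → Matrix J J ℝ} {k : ℕ}
    (h : ∀ i j, IsPolyOfDegreeLE (fun t => M t i j) k) :
    IsPolyOfDegreeLE (fun t => (M t).det) (Fintype.card J * k) := by
  simp only [Matrix.det_apply']
  exact sum fun σ _ => (prod fun i _ => h (σ i) i).const_mul _

theorem evalMatrix {d n m : ℕ} {J : Type*} (F : J → (Fin d → Fin n) → ℝ)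
    (col : J → NondecTuple d m) {X : ℝ → Fin n → Fin m → ℝ}
    (h : ∀ t i, IsPolyOfDegreeLE (fun u => X u t i) 1) (k k' : J) :
    IsPolyOfDegreeLE (fun u => evalMatrix F col (X u) k k') d := by
  simp only [evalMatrix_apply, tensorEval]
  refine sum fun r _ => const_mul _ ?_
  simpa using prod (s := Finset.univ) fun b _ => h (r b) ((col k').1 b)

end IsPolyOfDegreeLE

theorem tensorEval_single {d n : ℕ} (f : (Fin d → Fin n) → ℝ) (r : Fin d → Fin n) :
    tensorEval f (fun b => Pi.single (r b) 1) = f r := by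
  unfold tensorEval
  rw [Finset.sum_eq_single r]
  · simp
  · intro r' _ hr
    obtain ⟨b, hb⟩ := Function.ne_iff.1 hr
    rw [Finset.prod_eq_zero (Finset.mem_univ b), mul_zero]
    exact Pi.single_eq_of_ne hb _
  · simp

theorem abs_tensorEval_le {d n : ℕ} {f : (Fin d → Fin n) → ℝ} (hf : ∀ r, |f r| ≤ 1)
    {x : Fin d → Fin n → ℝ} {Y : ℝ} (hx : ∀ b t, |x b t| ≤ Y) :
    |tensorEval f x| ≤ (n : ℝ) ^ d * Y ^ d := by
  unfold tensorEval
  calc _ ≤ ∑ r : Fin d → Fin n, |f r * ∏ b, x b (r b)| := Finset.abs_sum_le_sum_abs _ _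
    _ ≤ ∑ r : Fin d → Fin n, Y ^ d := by
        refine Finset.sum_le_sum fun r _ => ?_
        rw [abs_mul, Finset.abs_prod]
        calc |f r| * ∏ b, |x b (r b)| ≤ 1 * ∏ _b : Fin d, Y :=
              mul_le_mul (hf r) (Finset.prod_le_prod (fun _ _ => abs_nonneg _)
                fun b _ => hx b (r b)) (Finset.prod_nonneg fun _ _ => abs_nonneg _) zero_le_one
          _ = Y ^ d := by simp
    _ = _ := by simp

/-! ### A long triangular sequence of forms -/

/-- Symmetric tensors orthogonal to given tensors, vanishing on given vectors, each of which
vanishes on the coordinates at which the previous ones are largest. -/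
theorem exists_seq_isSymmTensor {e n : ℕ} {ι₁ ι₂ : Type*} [Fintype ι₁] [Fintype ι₂]
    (w : ι₁ → (Fin (e + 1) → Fin n) → ℝ) (y : ι₂ → Fin n → ℝ) (Q : ℕ)
    (hcard : Fintype.card ι₁ + (Fintype.card ι₂ + Q * (e + 1)) * Fintype.card (NondecTuple e n) <
      Fintype.card (NondecTuple (e + 1) n)) :
    ∃ (f : ℕ → (Fin (e + 1) → Fin n) → ℝ) (τ : ℕ → Fin (e + 1) → Fin n), ∀ l < Q,
      IsSymmTensor (f l) ∧ (∀ r, |f l r| ≤ 1) ∧ f l (τ l) = 1 ∧ (∀ i, ∑ r, f l r * w i r = 0) ∧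
      (∀ i x b, x b = y i → tensorEval (f l) x = 0) ∧
      ∀ l' < l, ∀ r b a, r b = τ l' a → f l r = 0 := by
  induction Q with
  | zero =>
    have hpos : 0 < Fintype.card (NondecTuple (e + 1) n) := by omega
    obtain ⟨k⟩ := Fintype.card_pos_iff.1 hpos
    exact ⟨fun _ _ => 0, fun _ => k.1, fun l hl => absurd hl (by omega)⟩
  | succ Q ih =>
    have hle : Fintype.card ι₁ + (Fintype.card ι₂ + Q * (e + 1)) *
        Fintype.card (NondecTuple e n) < Fintype.card (NondecTuple (e + 1) n) := by
      refine lt_of_le_of_lt ?_ hcard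
      gcongr
      omega
    obtain ⟨f, τ, h⟩ := ih hle
    -- The earlier pivots enter as standard basis vectors: vanishing on `e_{τ l' a}` in any slot
    -- means that all coefficients whose index tuple meets `τ l' a` are zero.
    obtain ⟨g, σ, h1, h2, h3, h4, h5⟩ := exists_isSymmTensor w
      (Sum.elim y fun p : Fin Q × Fin (e + 1) => Pi.single (τ p.1 p.2) 1) (by
        rw [Fintype.card_sum, Fintype.card_prod, Fintype.card_fin, Fintype.card_fin]; exact hle)
    refine ⟨Function.update f Q g, Function.update τ Q σ, fun l hl => ?_⟩
    rcases Nat.lt_succ_iff_lt_or_eq.1 hl with hlQ | rfl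
    · rw [Function.update_of_ne hlQ.ne, Function.update_of_ne hlQ.ne]
      obtain ⟨a1, a2, a3, a4, a5, a6⟩ := h l hlQ
      refine ⟨a1, a2, a3, a4, a5, fun l' hl' r b a hr => a6 l' hl' r b a ?_⟩
      rwa [Function.update_of_ne (by omega)] at hr
    · rw [Function.update_self, Function.update_self]
      refine ⟨h1, h2, h3, h4, fun i => h5 (Sum.inl i), fun l' hl' r b a hr => ?_⟩
      rw [Function.update_of_ne (by omega)] at hr
      rw [← tensorEval_single g r]
      exact h5 (Sum.inr (⟨l', hl'⟩, a)) _ b (by simp [hr])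

/-! ### Perturbed blocks and near dependence -/

section Blocks

variable {s n m : ℕ}

/-- The perturbed blocks `P i + z i`, rescaled by `lam`. -/
def scaledBlocks (P : Fin s → Matrix (Fin n) (Fin m) ℝ) (lam : ℝ)
    (z : Fin s × Fin n × Fin m → ℝ) (i : Fin s) : Matrix (Fin n) (Fin m) ℝ :=
  Matrix.of fun t h => lam * (P i t h + z (i, t, h))

/-- The event that the column `c₀` of the lift of the scaled blocks almost depends linearly on the
other columns. -/
def nearDependent (d : ℕ) (P : Fin s → Matrix (Fin n) (Fin m) ℝ) (lam τ : ℝ)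
    (c₀ : Fin s × NondecTuple d m) : Set (Fin s × Fin n × Fin m → ℝ) :=
  {z | ∃ c : Fin s × NondecTuple d m → ℝ, c c₀ = 1 ∧
    ∀ r, |∑ j, c j * blockLift d (scaledBlocks P lam z) r j| < τ}

theorem continuous_scaledBlocks (P : Fin s → Matrix (Fin n) (Fin m) ℝ) (lam : ℝ) (i : Fin s)
    (t : Fin n) (h : Fin m) : Continuous fun z => scaledBlocks P lam z i t h := by
  simp only [scaledBlocks, Matrix.of_apply]
  fun_prop

/-- For a fixed coefficient vector the condition is open in `z`, and the event is the union over all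
coefficient vectors; openness provides measurability in spite of the uncountable union. -/
theorem isOpen_nearDependent (d : ℕ) (P : Fin s → Matrix (Fin n) (Fin m) ℝ) (lam τ : ℝ)
    (c₀ : Fin s × NondecTuple d m) : IsOpen (nearDependent d P lam τ c₀) := by
  have : nearDependent d P lam τ c₀ = ⋃ c : {c : Fin s × NondecTuple d m → ℝ // c c₀ = 1},
      ⋂ r, {z | |∑ j, c.1 j * blockLift d (scaledBlocks P lam z) r j| < τ} := by
    ext z
    simp [nearDependent]
  rw [this]
  refine isOpen_iUnion fun c => isOpen_iInter_of_finite fun r => isOpen_lt ?_ continuous_const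
  simp only [blockLift, symKronPow, Matrix.of_apply]
  have := continuous_scaledBlocks P lam
  fun_prop

theorem continuous_det_evalMatrix {d : ℕ} {J : Type*} [Fintype J] [DecidableEq J]
    (F : J → (Fin d → Fin n) → ℝ) (col : J → NondecTuple d m)
    (P : Fin s → Matrix (Fin n) (Fin m) ℝ) (lam : ℝ) (i : Fin s) :
    Continuous fun z => (evalMatrix F col (scaledBlocks P lam z i)).det := by
  refine Continuous.matrix_det (continuous_matrix fun k k' => ?_)
  change Continuous fun z => tensorEval (F k) fun b t => scaledBlocks P lam z i t ((col k').1 b)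
  unfold tensorEval
  have := continuous_scaledBlocks P lam i
  fun_prop

theorem isPolyOfDegreeLE_det_evalMatrix {d : ℕ} {J : Type*} [Fintype J] [DecidableEq J]
    (F : J → (Fin d → Fin n) → ℝ) (col : J → NondecTuple d m)
    (P : Fin s → Matrix (Fin n) (Fin m) ℝ) (lam : ℝ) (i : Fin s)
    (z : Fin s × Fin n × Fin m → ℝ) (c : Fin s × Fin n × Fin m) :
    IsPolyOfDegreeLE (fun u => (evalMatrix F col
      (scaledBlocks P lam (Function.update z c u) i)).det) (Fintype.card J * d) := by
  refine IsPolyOfDegreeLE.det fun k k' => IsPolyOfDegreeLE.evalMatrix F col (fun t h => ?_) k k'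
  simp only [scaledBlocks, Matrix.of_apply]
  refine IsPolyOfDegreeLE.const_mul _ ?_
  by_cases hc : (i, t, h) = c
  · subst hc
    exact ⟨Polynomial.X + Polynomial.C (P i t h), by compute_degree, by
      intro u; simp [add_comm]⟩
  · simp only [Function.update_of_ne hc]
    exact IsPolyOfDegreeLE.const _ _

end Blocks

/-! ### One batch of forms -/

section Batch

variable {s n m d : ℕ} {J : Type*} [Fintype J]

omit [Fintype J] in
theorem evalMatrix_congr {F : J → (Fin d → Fin n) → ℝ} {col : J → NondecTuple d m}
    {X X' : Fin n → Fin m → ℝ}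
    (h : ∀ k k' r, F k r ≠ 0 → ∀ b, X (r b) ((col k').1 b) = X' (r b) ((col k').1 b)) :
    evalMatrix F col X = evalMatrix F col X' :=
  Matrix.ext fun k k' => (evalMatrix_apply F col X k k').trans
    ((tensorEval_congr (h k k')).trans (evalMatrix_apply F col X' k k').symm)

/-- The positions in the `i`-th block at which a system of forms is perturbed. -/
def pivotPositions (i : Fin s) (τ : J → Fin d → Fin n) (col : J → NondecTuple d m) :
    Finset (Fin s × Fin n × Fin m) :=
  Finset.univ.image fun p : J × Fin d => (i, τ p.1 p.2, (col p.1).1 p.2)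

theorem mem_pivotPositions {i : Fin s} {τ : J → Fin d → Fin n} {col : J → NondecTuple d m}
    {c : Fin s × Fin n × Fin m} :
    c ∈ pivotPositions i τ col ↔ ∃ k a, (i, τ k a, (col k).1 a) = c := by
  simp [pivotPositions]

variable [DecidableEq J]

/-- The event that the entries at the pivot positions are bounded, but the determinant of a system
of forms at the columns of the `i`-th block is small. -/
def smallDet (F : J → (Fin d → Fin n) → ℝ) (τ : J → Fin d → Fin n) (col : J → NondecTuple d m)
    (P : Fin s → Matrix (Fin n) (Fin m) ℝ) (lam W κ : ℝ) (i : Fin s) :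
    Set (Fin s × Fin n × Fin m → ℝ) :=
  {z | (∀ c ∈ pivotPositions i τ col, |z c| ≤ W) ∧
    |(evalMatrix F col (scaledBlocks P lam z i)).det| < κ}

theorem measurableSet_smallDet (F : J → (Fin d → Fin n) → ℝ) (τ : J → Fin d → Fin n)
    (col : J → NondecTuple d m) (P : Fin s → Matrix (Fin n) (Fin m) ℝ) (lam W κ : ℝ) (i : Fin s) :
    MeasurableSet (smallDet F τ col P lam W κ i) := by
  refine MeasurableSet.inter ?_ ?_
  · have : {z : Fin s × Fin n × Fin m → ℝ | ∀ c ∈ pivotPositions i τ col, |z c| ≤ W} =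
        ⋂ c ∈ pivotPositions i τ col, {z | |z c| ≤ W} := by ext; simp
    change MeasurableSet {z : Fin s × Fin n × Fin m → ℝ | ∀ c ∈ pivotPositions i τ col, |z c| ≤ W}
    rw [this]
    exact Finset.measurableSet_biInter _ fun c _ => measurableSet_le (by fun_prop) measurable_const
  · exact measurableSet_lt (continuous_det_evalMatrix F col P lam i).abs.measurable measurable_const

/-- The determinant has degree at most `D * d` in each entry, and there are at most `D * d` pivot
entries; this explains both the exponent and the squared prefactor. -/
theorem lmarginal_smallDet_le {ν : Measure ℝ} [IsProbabilityMeasure ν] {W μ : ℝ} {p₁ : ENNReal}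
    (hp₁ : ∀ z, ν (Set.Icc (z - μ) (z + μ)) ≤ p₁) (hμ : 0 < μ) (hμW : μ ≤ W)
    {F : J → (Fin d → Fin n) → ℝ} (hF : ∀ k, IsSymmTensor (F k))
    {τ : J → Fin d → Fin n} (hτ : ∀ k, F k (τ k) = 1) {col : J → NondecTuple d m}
    (hcol : Function.Injective col) {D D₀ : ℕ} (hD : D ≤ D₀) (e : J ≃ Fin D)
    (hkill : ∀ k k', e k < e k' → ∀ r b a, r b = τ k a → F k' r = 0)
    {P : Fin s → Matrix (Fin n) (Fin m) ℝ} (hP : ∀ i t h, |P i t h| ≤ 1)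
    {lam : ℝ} (hlam : 0 < lam) (hW : d * D₀ / lam + 1 ≤ W) {κ : ℝ}
    (hκ : κ ≤ ((2 ^ d)⁻¹ : ℝ) ^ D₀ * (μ / (4 * W)) ^ (D₀ * d * (D₀ * d))) (i : Fin s)
    (x : Fin s × Fin n × Fin m → ℝ) :
    (∫⋯∫⁻_(pivotPositions i τ col), (smallDet F τ col P lam W κ i).indicator 1 ∂(fun _ => ν)) x ≤
      ((D₀ * d : ℕ) : ENNReal) * ((D₀ * d : ℕ) * p₁) := by
  set S := pivotPositions i τ col with hS
  have hcardJ : Fintype.card J = D := by rw [Fintype.card_congr e, Fintype.card_fin]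
  have hScard : S.card ≤ D₀ * d := by
    refine Finset.card_image_le.trans ?_
    rw [Finset.card_univ, Fintype.card_prod, hcardJ, Fintype.card_fin]
    gcongr
  have hWpos : 0 < W := hμ.trans_le hμW
  -- The pivot entries are set to zero first, so that their values in the witness `X` are at most `d
  -- * D` however large `x` is. Undoing the map `z ↦ lam * (P + z)` at the pivots then gives a point
  -- of the box.
  obtain ⟨X, hX₁, hX₂, hX₃⟩ := exists_det_evalMatrix_ge hF hτ hcol e hkill
    (fun t h => if (i, t, h) ∈ S then 0 else scaledBlocks P lam x i t h)
  set x' : Fin s × Fin n × Fin m → ℝ := fun c =>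
    if c ∈ S then X c.2.1 c.2.2 / lam - P c.1 c.2.1 c.2.2 else x c with hx'
  have hblock : scaledBlocks P lam x' i = X := by
    funext t h
    by_cases hc : (i, t, h) ∈ S
    · simp only [scaledBlocks, hx', Matrix.of_apply, if_pos hc]
      field_simp
      ring
    · rw [hX₁ t h fun k a ht hh => hc (mem_pivotPositions.2 ⟨k, a, by rw [ht, hh]⟩), if_neg hc]
      simp only [scaledBlocks, hx', Matrix.of_apply, if_neg hc]
  have hr0 : 0 ≤ μ / (4 * W) := by positivity
  have hr1 : μ / (4 * W) ≤ 1 := by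
    rw [div_le_one (by positivity)]; linarith
  have hh1 : ((2 ^ d)⁻¹ : ℝ) ≤ 1 := inv_le_one_of_one_le₀ (one_le_pow₀ one_le_two)
  have main := lmarginal_sublevel_le (ν := ν) hp₁ hμ hμW (k := D * d)
    (φ := fun z => (evalMatrix F col (scaledBlocks P lam z i)).det)
    (continuous_det_evalMatrix F col P lam i).measurable
    (fun z c => by
      rw [← hcardJ]; exact isPolyOfDegreeLE_det_evalMatrix F col P lam i z c) S
    (((2 ^ d)⁻¹ : ℝ) ^ D) x x' (fun c hc => by simp only [hx', if_neg hc]) (fun c hc => by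
      have h1 : |X c.2.1 c.2.2| ≤ d * D := by
        obtain ⟨k, a, hka⟩ := mem_pivotPositions.1 hc
        have h2 := hX₂ c.2.1 c.2.2
        rwa [if_pos (by rw [← hka] at hc ⊢; exact hc), sub_zero] at h2
      simp only [hx', if_pos hc]
      refine (abs_sub _ _).trans (le_trans (add_le_add ?_ (hP _ _ _)) hW)
      rw [abs_div, abs_of_pos hlam]
      have : (D : ℝ) ≤ D₀ := Nat.cast_le.2 hD
      gcongr
      exact h1.trans (by gcongr)) (by simp only [hblock]; exact hX₃)
  refine (lmarginal_mono ?_ x).trans (main.trans ?_)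
  · refine Set.indicator_le_indicator_of_subset ?_ (by simp)
    rintro z ⟨hz1, hz2⟩
    refine ⟨hz1, hz2.trans_le (hκ.trans ?_)⟩
    refine mul_le_mul ?_ ?_ (by positivity) (by positivity)
    · exact pow_le_pow_of_le_one (by positivity) hh1 hD
    · refine pow_le_pow_of_le_one hr0 hr1 ?_
      gcongr
  · gcongr

end Batch

/-! ### The probability that one column is nearly dependent -/

section Leaf

variable {s n m e : ℕ}

/-- This keeps the determinants of a size depending on `d` only. -/
theorem card_tuples_le (d : ℕ) (H : Finset (Fin m)) (hH : H.card ≤ d) :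
    Fintype.card {k : NondecTuple d m // ∀ a, k.1 a ∈ H} ≤ d ^ d := by
  calc _ ≤ Fintype.card (Fin d → H) :=
        Fintype.card_le_of_injective (fun k a => ⟨k.1.1 a, k.2 a⟩) fun k k' h => by
          apply Subtype.ext; apply Subtype.ext; funext a
          exact congrArg Subtype.val (congrFun h a)
    _ = H.card ^ d := by simp
    _ ≤ d ^ d := by gcongr

/-- Near dependence of a column forces the determinant of an orthogonal system of forms to be
small. -/
theorem abs_det_evalMatrix_le {d : ℕ} {B : Fin s → Matrix (Fin n) (Fin m) ℝ} {i₀ : Fin s}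
    {J : Type*} [Fintype J] [DecidableEq J] {D₀ : ℕ} (hJ : Fintype.card J ≤ D₀)
    {col : J → NondecTuple d m} (hcol : Function.Injective col)
    {F : J → (Fin d → Fin n) → ℝ} (hF : ∀ k, IsSymmTensor (F k)) (hF1 : ∀ k r, |F k r| ≤ 1)
    (hother : ∀ k i k', i ≠ i₀ → ∑ r, F k r * symKronPow d (B i) r k' = 0)
    (hnot : ∀ k, ∀ k' : NondecTuple d m, k' ∉ Set.range col → tensorEval (F k) (fun b t => B i₀ t (k'.1 b)) = 0)
    {E : ℝ} (hE1 : 1 ≤ E) (hE : ∀ k (k' : NondecTuple d m), |tensorEval (F k) (fun b t => B i₀ t (k'.1 b))| ≤ E)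
    (j : J) {c : Fin s × NondecTuple d m → ℝ} (hc : c (i₀, col j) = 1) {τ : ℝ}
    (hτ : ∀ r, |∑ p, c p * blockLift d B r p| ≤ τ) :
    |(evalMatrix F col (B i₀)).det| ≤ (n : ℝ) ^ d * (D₀ * (D₀.factorial * E ^ D₀)) * τ := by
  set M := evalMatrix F col (B i₀) with hM
  have hMle : ∀ k k', |M k k'| ≤ E := fun k k' => hE k (col k')
  -- Cramer's rule: combined with row `j` of the adjugate, the forms pair to `M.det` with the column
  -- `(i₀, col j)` and to `0` with all the others.
  set g : (Fin d → Fin n) → ℝ := fun r => ∑ k, M.adjugate j k * F k r with hg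
  have hadj : ∀ k, |M.adjugate j k| ≤ D₀.factorial * E ^ D₀ := by
    intro k
    rw [Matrix.adjugate_apply]
    have h1 := Matrix.det_le (abv := (AbsoluteValue.abs : AbsoluteValue ℝ ℝ))
      (A := M.updateRow k (Pi.single j 1)) (x := E) (fun a b => by
      rcases eq_or_ne a k with rfl | hak
      · rw [Matrix.updateRow_self]
        rcases eq_or_ne b j with rfl | hbj
        · simpa using hE1
        · simpa [hbj] using zero_le_one.trans hE1
      · rw [Matrix.updateRow_ne hak]
        exact hMle a b)
    refine le_trans h1 ?_
    rw [nsmul_eq_mul]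
    gcongr
  have hEpos : 0 < E := by linarith
  have hgle : ∀ r, |g r| ≤ D₀ * (D₀.factorial * E ^ D₀) := by
    intro r
    calc |g r| ≤ ∑ k, |M.adjugate j k * F k r| := Finset.abs_sum_le_sum_abs _ _
      _ ≤ ∑ _k : J, (D₀.factorial * E ^ D₀ : ℝ) := Finset.sum_le_sum fun k _ => by
          rw [abs_mul]
          exact (mul_le_mul (hadj k) (hF1 k r) (abs_nonneg _) (by positivity)).trans_eq (mul_one _)
      _ = Fintype.card J * (D₀.factorial * E ^ D₀ : ℝ) := by simp
      _ ≤ _ := by gcongr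
  have hpair : ∀ p : Fin s × NondecTuple d m, ∑ r, g r * blockLift d B r p =
      if p = (i₀, col j) then M.det else 0 := by
    rintro ⟨i, k'⟩
    have h1 : ∑ r, g r * blockLift d B r (i, k') =
        ∑ k, M.adjugate j k * ∑ r, F k r * symKronPow d (B i) r k' := by
      simp only [hg, Finset.sum_mul, Finset.mul_sum]
      rw [Finset.sum_comm]
      refine Finset.sum_congr rfl fun k _ => Finset.sum_congr rfl fun r _ => ?_
      simp only [blockLift, Matrix.of_apply]
      ring
    rw [h1]
    by_cases hi : i = i₀
    · subst hi
      simp only [sum_mul_symKronPow (hF _)]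
      by_cases hk' : k' ∈ Set.range col
      · obtain ⟨l, rfl⟩ := hk'
        have h2 : ∑ k, M.adjugate j k * M k l = if l = j then M.det else 0 := by
          have := congrFun (congrFun (Matrix.adjugate_mul M) j) l
          rw [Matrix.mul_apply] at this
          rw [this, Matrix.smul_apply, Matrix.one_apply, smul_eq_mul, mul_ite, mul_one, mul_zero]
          simp only [eq_comm]
        simp only [Prod.mk.injEq, true_and, hcol.eq_iff]
        exact h2
      · rw [if_neg fun h => hk' ⟨j, (Prod.ext_iff.1 h).2.symm⟩]
        exact Finset.sum_eq_zero fun k _ => by rw [hnot k k' hk', mul_zero]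
    · rw [if_neg fun h => hi (Prod.ext_iff.1 h).1]
      exact Finset.sum_eq_zero fun k _ => by rw [hother k i k' hi, mul_zero]
  have hdet : M.det = ∑ r, g r * ∑ p, c p * blockLift d B r p := by
    have h1 : ∑ r, g r * ∑ p, c p * blockLift d B r p =
        ∑ p, c p * ∑ r, g r * blockLift d B r p := by
      simp only [Finset.mul_sum]
      rw [Finset.sum_comm]
      exact Finset.sum_congr rfl fun p _ => Finset.sum_congr rfl fun r _ => by ring
    rw [h1]
    simp [hpair, hc]
  rw [hdet]
  calc _ ≤ ∑ r, |g r * ∑ p, c p * blockLift d B r p| := Finset.abs_sum_le_sum_abs _ _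
    _ ≤ ∑ _r : Fin d → Fin n, (D₀ * (D₀.factorial * E ^ D₀)) * τ :=
        Finset.sum_le_sum fun r _ => by
          rw [abs_mul]
          exact mul_le_mul (hgle r) (hτ r) (abs_nonneg _) (by positivity)
    _ = _ := by simp [mul_assoc]

theorem measurableSet_forall_lt {α : Type*} [MeasurableSpace α] {E : ℕ → Set α} {q : ℕ}
    (hE : ∀ b < q, MeasurableSet (E b)) : MeasurableSet {z | ∀ b < q, z ∈ E b} := by
  have : {z | ∀ b < q, z ∈ E b} = ⋂ b ∈ Finset.range q, E b := by ext; simp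
  rw [this]
  exact Finset.measurableSet_biInter _ fun b hb => hE b (by simpa using hb)

/-- The probability that a column of the lift is nearly dependent on the others, while all
entries are bounded. -/
theorem measure_nearDependent_le {ν : Measure ℝ} [IsProbabilityMeasure ν] {W μ : ℝ} {p₁ : ENNReal}
    (hp₁ : ∀ z, ν (Set.Icc (z - μ) (z + μ)) ≤ p₁) (hμ : 0 < μ) (hμW : μ ≤ W)
    {P : Fin s → Matrix (Fin n) (Fin m) ℝ} (hP : ∀ i t h, |P i t h| ≤ 1)
    {lam : ℝ} (hlam : 0 < lam) (hlam1 : lam ≤ 1) {D₀ : ℕ} (hD₀ : (e + 1) ^ (e + 1) ≤ D₀)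
    (hW : (e + 1 : ℕ) * D₀ / lam + 1 ≤ W) {K : ℝ} (hKW : K / lam ≤ W) {κ : ℝ}
    (hκ : κ ≤ ((2 ^ (e + 1))⁻¹ : ℝ) ^ D₀ *
      (μ / (4 * W)) ^ (D₀ * (e + 1) * (D₀ * (e + 1)))) {E τ : ℝ} (hE1 : 1 ≤ E)
    (hE : (n : ℝ) ^ (e + 1) * (1 + K) ^ (e + 1) ≤ E)
    (hτ : (n : ℝ) ^ (e + 1) * (D₀ * (D₀.factorial * E ^ D₀)) * τ < κ) {q : ℕ}
    (hdim : s * Fintype.card (NondecTuple (e + 1) m) +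
      (m + q * D₀ * (e + 1)) * Fintype.card (NondecTuple e n) <
        Fintype.card (NondecTuple (e + 1) n)) (i₀ : Fin s) (j₀ : NondecTuple (e + 1) m) :
    Measure.pi (fun _ : Fin s × Fin n × Fin m => ν)
      (nearDependent (e + 1) P lam τ (i₀, j₀) ∩ {z | ∀ c, |z c| ≤ K / lam}) ≤
        (((D₀ * (e + 1) : ℕ) : ENNReal) * ((D₀ * (e + 1) : ℕ) * p₁)) ^ q := by
  set H : Finset (Fin m) := Finset.univ.image j₀.1 with hH
  have hHcard : H.card ≤ e + 1 := Finset.card_image_le.trans_eq (by simp)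
  let J := {k : NondecTuple (e + 1) m // ∀ a, k.1 a ∈ H}
  set D := Fintype.card J with hDdef
  have hD : D ≤ D₀ := (card_tuples_le (e + 1) H hHcard).trans hD₀
  let col : J → NondecTuple (e + 1) m := Subtype.val
  have hcol : Function.Injective col := Subtype.val_injective
  let j : J := ⟨j₀, fun a => Finset.mem_image_of_mem _ (Finset.mem_univ a)⟩
  let ε : J ≃ Fin D := Fintype.equivFin J
  have hbox : MeasurableSet {z : Fin s × Fin n × Fin m → ℝ | ∀ c, |z c| ≤ K / lam} := by
    have : {z : Fin s × Fin n × Fin m → ℝ | ∀ c, |z c| ≤ K / lam} =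
        ⋂ c, {z | |z c| ≤ K / lam} := by ext; simp
    rw [this]
    exact MeasurableSet.iInter fun c => measurableSet_le (by fun_prop) measurable_const
  -- Only the columns of block `i₀` with index in `H` stay random. The forms may depend on the
  -- frozen entries `x`, and no measurable choice of them is needed, since a covering event for each
  -- `x` suffices.
  refine measure_pi_le_of_forall_section (S := Finset.univ.filter fun c => c.1 = i₀ ∧ c.2.2 ∈ H)
    ((isOpen_nearDependent _ _ _ _ _).measurableSet.inter hbox) fun x => ?_
  -- The conditions from block `i₀` and from the columns in `H` are replaced by vacuous ones (zero
  -- vectors), which keeps the index types and the dimension count simple.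
  obtain ⟨f, σ, hf⟩ := exists_seq_isSymmTensor (n := n) (e := e)
    (fun (p : Fin s × NondecTuple (e + 1) m) r =>
      if p.1 = i₀ then 0 else symKronPow (e + 1) (scaledBlocks P lam x p.1) r p.2)
    (fun (h : Fin m) => if h ∈ H then 0 else fun t => scaledBlocks P lam x i₀ t h) (q * D) (by
      rw [Fintype.card_prod, Fintype.card_fin, Fintype.card_fin]
      refine lt_of_le_of_lt ?_ hdim
      gcongr)
  -- Batch `b` consists of the forms numbered `b * D` to `b * D + D - 1`.
  let F : ℕ → J → (Fin (e + 1) → Fin n) → ℝ := fun b k => f (b * D + ε k)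
  let T : ℕ → J → Fin (e + 1) → Fin n := fun b k => σ (b * D + ε k)
  have hidx : ∀ b < q, ∀ k : J, b * D + ε k < q * D := fun b hb k => by
    calc b * D + ε k < b * D + D := by have := (ε k).2; omega
      _ = (b + 1) * D := by ring
      _ ≤ q * D := by gcongr; omega
  have hrow : ∀ b < q, ∀ k : J, _ := fun b hb k => hf _ (hidx b hb k)
  have hkill : ∀ b < q, ∀ k k', ε k < ε k' → ∀ r c a, r c = T b k a → F b k' r = 0 :=
    fun b hb k k' hkk r c a hr =>
      (hrow b hb k').2.2.2.2.2 _ (by have := Fin.lt_def.1 hkk; omega) r c a hr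
  have hkill' : ∀ b b', b < b' → b' < q → ∀ k k', ∀ r c a, r c = T b k a → F b' k' r = 0 := by
    intro b b' hbb hb' k k' r c a hr
    refine (hrow b' hb' k').2.2.2.2.2 (b * D + ε k) ?_ r c a hr
    calc b * D + ε k < b * D + D := by have := (ε k).2; omega
      _ = (b + 1) * D := by ring
      _ ≤ b' * D := by gcongr; omega
      _ ≤ _ := by omega
  refine ⟨{z | ∀ b < q, z ∈ smallDet (F b) (T b) col P lam W κ i₀},
    measurableSet_forall_lt fun b _ => measurableSet_smallDet _ _ _ _ _ _ _ _, ?_, ?_, ?_⟩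
  · intro z z' hzz hz b hb
    obtain ⟨h1, h2⟩ := hz b hb
    refine ⟨fun c hc => ?_, ?_⟩
    · rw [← hzz c]
      · exact h1 c hc
      · obtain ⟨k, a, rfl⟩ := mem_pivotPositions.1 hc
        simpa using k.2 a
    · have : evalMatrix (F b) col (scaledBlocks P lam z' i₀) =
          evalMatrix (F b) col (scaledBlocks P lam z i₀) := by
        refine evalMatrix_congr fun k k' r _ c => ?_
        simp only [scaledBlocks, Matrix.of_apply]
        rw [hzz (i₀, r c, (col k').1 c) (by simpa using k'.2 c)]
      rw [this]
      exact h2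
  · refine measure_pi_biInter_le _ q (fun b => pivotPositions i₀ (T b) col) _
      (fun b _ => measurableSet_smallDet _ _ _ _ _ _ _ _) (fun b hb x => ?_) ?_
    · exact lmarginal_smallDet_le hp₁ hμ hμW (fun k => (hrow b hb k).1)
        (fun k => (hrow b hb k).2.2.1) hcol hD ε (hkill b hb) hP hlam hW hκ i₀ x
    · rintro b b' hbb hb' z z' hzz ⟨h1, h2⟩
      refine ⟨fun c hc => ?_, ?_⟩
      · rw [← hzz c]
        · exact h1 c hc
        -- A pivot entry shared with an earlier batch would force the coefficient of `F b' k'` at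
        -- its own pivot, which is `1`, to vanish.
        · intro hcb
          obtain ⟨k', a', rfl⟩ := mem_pivotPositions.1 hc
          obtain ⟨k, a, hka⟩ := mem_pivotPositions.1 hcb
          have h3 := hkill' b b' hbb hb' k k' (T b' k') a' a
            (Prod.ext_iff.1 (Prod.ext_iff.1 hka).2).1.symm
          rw [show F b' k' (T b' k') = 1 from (hrow b' hb' k').2.2.1] at h3
          exact one_ne_zero h3
      · have : evalMatrix (F b') col (scaledBlocks P lam z' i₀) =
            evalMatrix (F b') col (scaledBlocks P lam z i₀) := by
          refine evalMatrix_congr fun k k' r hr c => ?_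
          simp only [scaledBlocks, Matrix.of_apply]
          rw [hzz (i₀, r c, (col k').1 c)]
          intro hcb
          obtain ⟨l, a, hla⟩ := mem_pivotPositions.1 hcb
          exact hr (hkill' b b' hbb hb' l k r c a
            (Prod.ext_iff.1 (Prod.ext_iff.1 hla).2).1.symm)
        rw [this]
        exact h2
  · rintro z ⟨⟨c, hc1, hc2⟩, hzbox⟩ hzx b hb
    have hblock : ∀ i, i ≠ i₀ → scaledBlocks P lam z i = scaledBlocks P lam x i := by
      intro i hi
      funext t h
      simp only [scaledBlocks, Matrix.of_apply]
      rw [hzx (i, t, h) (by simp [hi])]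
    have hcolumn : ∀ h ∉ H, ∀ t, scaledBlocks P lam z i₀ t h = scaledBlocks P lam x i₀ t h := by
      intro h hh t
      simp only [scaledBlocks, Matrix.of_apply]
      rw [hzx (i₀, t, h) (by simp [hh])]
    have hentry : ∀ t h, |scaledBlocks P lam z i₀ t h| ≤ 1 + K := by
      intro t h
      simp only [scaledBlocks, Matrix.of_apply]
      rw [abs_mul, abs_of_pos hlam]
      calc lam * |P i₀ t h + z (i₀, t, h)| ≤ lam * (1 + K / lam) := by
            gcongr
            exact (abs_add_le _ _).trans (add_le_add (hP _ _ _) (hzbox _))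
        _ = lam + K := by field_simp
        _ ≤ 1 + K := by gcongr
    refine ⟨fun c _ => (hzbox c).trans hKW, lt_of_le_of_lt ?_ hτ⟩
    refine abs_det_evalMatrix_le (d := e + 1) (B := scaledBlocks P lam z) (i₀ := i₀) hD hcol
      (F := F b) (fun k => (hrow b hb k).1) (fun k => (hrow b hb k).2.1) ?_ ?_ hE1 ?_ j hc1
      fun r => (hc2 r).le
    · intro k i k' hi
      have := (hrow b hb k).2.2.2.1 (i, k')
      simp only [if_neg hi] at this
      rw [hblock i hi]
      exact this
    -- A tuple outside `J` uses a frozen column of block `i₀`, on which the forms vanish by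
    -- construction.
    · intro k k' hk'
      obtain ⟨a, ha⟩ : ∃ a, k'.1 a ∉ H := by
        by_contra hcon
        push Not at hcon
        exact hk' ⟨⟨k', hcon⟩, rfl⟩
      refine (hrow b hb k).2.2.2.2.1 (k'.1 a) _ a ?_
      rw [if_neg ha]
      exact funext fun t => hcolumn _ ha t
    · intro k k'
      exact (abs_tensorEval_le (hrow b hb k).2.1 fun b t => hentry t _).trans hE

end Leaf

/-! ### Least singular value and change of basis -/

theorem le_leastSingularValue {α β : Type*} [Fintype α] [Fintype β] [DecidableEq β] [Nonempty β]
    {A : Matrix α β ℝ} {a : ℝ}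
    (h : ∀ v : EuclideanSpace ℝ β, a * ‖v‖ ≤ ‖A.toEuclideanLin v‖) : a ≤ leastSingularValue A := by
  have hlt : Fintype.card β - 1 < Module.finrank ℝ (EuclideanSpace ℝ β) := by
    rw [finrank_euclideanSpace]
    have := Fintype.card_pos (α := β)
    omega
  set T := A.toEuclideanLin with hT
  obtain ⟨v, hv⟩ := (T.hasEigenvalue_adjoint_comp_self_sq_singularValues hlt).exists_hasEigenvector
  have hv1 := hv.apply_eq_smul
  have hv0 : 0 < ‖v‖ := norm_pos_iff.2 hv.2
  have h1 : ‖T v‖ ^ 2 = T.singularValues (Fintype.card β - 1) ^ 2 * ‖v‖ ^ 2 := by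
    rw [← real_inner_self_eq_norm_sq, ← LinearMap.adjoint_inner_left,
      ← LinearMap.comp_apply, hv1, real_inner_smul_left, real_inner_self_eq_norm_sq]
    rfl
  have h2 : ‖T v‖ = T.singularValues (Fintype.card β - 1) * ‖v‖ := by
    rw [← mul_pow] at h1
    exact (pow_left_inj₀ (norm_nonneg _)
      (mul_nonneg (T.singularValues_nonneg _) hv0.le) two_ne_zero).1 h1
  have h3 := h v
  rw [h2] at h3
  exact le_of_mul_le_mul_right h3 hv0

section SymKron

variable {d n m : ℕ}

/-- The symmetrized product of the columns of `U` indexed by an arbitrary tuple. -/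
noncomputable def symKronTuple (U : Matrix (Fin n) (Fin m) ℝ) (r : Fin d → Fin n)
    (g : Fin d → Fin m) : ℝ :=
  (1 / (d.factorial : ℝ)) * ∑ π : Equiv.Perm (Fin d), ∏ j : Fin d, U (r j) (g (π j))

theorem symKronTuple_eq_sortTuple (U : Matrix (Fin n) (Fin m) ℝ) (r : Fin d → Fin n)
    (g : Fin d → Fin m) : symKronTuple U r g = symKronPow d U r (sortTuple g) := by
  simp only [symKronTuple, symKronPow, Matrix.of_apply, sortTuple, Function.comp_apply]
  congr 1
  exact (Fintype.sum_equiv (Equiv.mulLeft (Tuple.sort g)) _ _ fun π => by simp).symm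

theorem sum_mul_symKronTuple {A : Type*} [Fintype A] (U : Matrix (Fin n) (Fin m) ℝ)
    (r : Fin d → Fin n) (a : A → ℝ) (g : A → Fin d → Fin m) :
    ∑ i, a i * symKronTuple U r (g i) =
      ∑ k, (∑ i with sortTuple (g i) = k, a i) * symKronPow d U r k := by
  rw [← Finset.sum_fiberwise Finset.univ fun i => sortTuple (g i)]
  refine Finset.sum_congr rfl fun k _ => ?_
  rw [Finset.sum_mul]
  refine Finset.sum_congr rfl fun i hi => ?_
  rw [symKronTuple_eq_sortTuple, (Finset.mem_filter.1 hi).2]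

theorem symKronPow_mul (B : Matrix (Fin n) (Fin m) ℝ) (R : Matrix (Fin m) (Fin m) ℝ)
    (r : Fin d → Fin n) (k : NondecTuple d m) :
    symKronPow d (B * R) r k =
      ∑ g : Fin d → Fin m, (∏ b, R (g b) (k.1 b)) * symKronTuple B r g := by
  simp only [symKronPow, symKronTuple, Matrix.of_apply]
  have h : ∀ π : Equiv.Perm (Fin d), ∏ j, (B * R) (r j) (k.1 (π j)) =
      ∑ g : Fin d → Fin m, (∏ b, R (g b) (k.1 b)) * ∏ j, B (r j) (g (π j)) := by
    intro π
    simp only [Matrix.mul_apply]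
    rw [Finset.prod_univ_sum, Fintype.piFinset_univ]
    refine Fintype.sum_equiv (π.arrowCongr (Equiv.refl (Fin m))) _ _ fun g => ?_
    rw [Finset.prod_mul_distrib, mul_comm]
    congr 1
    · exact Fintype.prod_equiv π _ _ fun j => by simp [Equiv.arrowCongr]
    · simp [Equiv.arrowCongr]
  simp only [h, Finset.mul_sum]
  rw [Finset.sum_comm]
  refine Finset.sum_congr rfl fun g _ => Finset.sum_congr rfl fun π _ => by ring

theorem abs_symKronPow_le {B : Matrix (Fin n) (Fin m) ℝ} {Y : ℝ} (hB : ∀ t h, |B t h| ≤ Y)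
    (r : Fin d → Fin n) (k : NondecTuple d m) : |symKronPow d B r k| ≤ Y ^ d := by
  simp only [symKronPow, Matrix.of_apply]
  rw [abs_mul, abs_of_pos (by positivity)]
  calc _ ≤ 1 / (d.factorial : ℝ) * ∑ _π : Equiv.Perm (Fin d), Y ^ d := by
        gcongr
        refine (Finset.abs_sum_le_sum_abs _ _).trans (Finset.sum_le_sum fun π _ => ?_)
        rw [Finset.abs_prod]
        exact (Finset.prod_le_prod (fun _ _ => abs_nonneg _) fun j _ => hB _ _).trans_eq (by simp)
    _ = Y ^ d := by
        rw [Finset.sum_const, Finset.card_univ, Fintype.card_perm, Fintype.card_fin, nsmul_eq_mul]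
        field_simp

/-- Orthonormality turns the sum over `r` into a product of Kronecker deltas. The unsymmetrized
products of columns are thus dual to the lifted columns, up to factors of at least `1 / d!`. -/
theorem sum_prod_mul_symKronPow {V : Matrix (Fin n) (Fin m) ℝ} (hV : Vᵀ * V = 1)
    (k k' : NondecTuple d m) :
    ∑ r : Fin d → Fin n, (∏ b, V (r b) (k.1 b)) * symKronPow d V r k' =
      if k = k' then
        1 / (d.factorial : ℝ) *
          ((Finset.univ.filter fun π : Equiv.Perm (Fin d) => k.1 ∘ π = k.1).card : ℝ)
      else 0 := by
  have hVV : ∀ h h', ∑ t, V t h * V t h' = if h = h' then 1 else 0 := by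
    intro h h'
    have := congrFun (congrFun hV h) h'
    rwa [Matrix.mul_apply, Matrix.one_apply] at this
  have h1 : ∀ π : Equiv.Perm (Fin d), ∑ r : Fin d → Fin n,
      (∏ b, V (r b) (k.1 b)) * ∏ j, V (r j) (k'.1 (π j)) = if k'.1 ∘ π = k.1 then 1 else 0 := by
    intro π
    have h2 := Finset.prod_univ_sum (fun _ : Fin d => (Finset.univ : Finset (Fin n)))
      (fun b t => V t (k.1 b) * V t (k'.1 (π b)))
    rw [Fintype.piFinset_univ] at h2
    simp only [← Finset.prod_mul_distrib]
    rw [← h2]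
    simp only [hVV]
    rw [Finset.prod_boole]
    simp [funext_iff, eq_comm]
  have h3 : ∑ r : Fin d → Fin n, (∏ b, V (r b) (k.1 b)) * symKronPow d V r k' =
      1 / (d.factorial : ℝ) * ∑ π : Equiv.Perm (Fin d), if k'.1 ∘ π = k.1 then 1 else 0 := by
    simp only [symKronPow, Matrix.of_apply, Finset.mul_sum, ← h1]
    rw [Finset.sum_comm]
    refine Finset.sum_congr rfl fun π _ => Finset.sum_congr rfl fun r _ => by ring
  rw [h3]
  split_ifs with hk
  · subst hk
    rw [Finset.sum_boole]
  · rw [Finset.sum_eq_zero, mul_zero]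
    exact fun π _ => if_neg fun h => hk (NondecTuple.eq_of_comp_perm h).symm

theorem abs_le_one_of_transpose_mul_self {V : Matrix (Fin n) (Fin m) ℝ} (hV : Vᵀ * V = 1)
    (t : Fin n) (h : Fin m) : |V t h| ≤ 1 := by
  have h1 := congrFun (congrFun hV h) h
  rw [Matrix.mul_apply, Matrix.one_apply_eq] at h1
  rw [← sq_le_one_iff_abs_le_one, ← h1]
  have := Finset.single_le_sum (f := fun t => Vᵀ h t * V t h)
    (fun t _ => by simpa using mul_self_nonneg (V t h)) (Finset.mem_univ t)
  simpa [sq] using this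

end SymKron

section Deterministic

variable {s n m e : ℕ} {B : Fin s → Matrix (Fin n) (Fin m) ℝ} {τ : ℝ}

/-- Dividing by `β p` normalizes the coefficient at `p` to `1`, where the hypothesis on `B` applies.
-/
theorem abs_coeff_mul_le {d : ℕ}
    (hB : ∀ c₀, ∀ c : Fin s × NondecTuple d m → ℝ, c c₀ = 1 →
      ∃ r, τ ≤ |∑ j, c j * blockLift d B r j|)
    {β : Fin s × NondecTuple d m → ℝ} {t : ℝ} (ht : ∀ r, |∑ j, β j * blockLift d B r j| ≤ t)
    (ht0 : 0 ≤ t) (p : Fin s × NondecTuple d m) : |β p| * τ ≤ t := by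
  by_cases hp : β p = 0
  · simpa [hp] using ht0
  · obtain ⟨r, hr⟩ := hB p (fun j => β j / β p) (div_self hp)
    have h1 : ∑ j, β j / β p * blockLift d B r j = (β p)⁻¹ * ∑ j, β j * blockLift d B r j := by
      rw [Finset.mul_sum]
      exact Finset.sum_congr rfl fun j _ => by ring
    rw [h1, abs_mul, abs_inv] at hr
    have hpos := abs_pos.2 hp
    calc |β p| * τ ≤ |β p| * (|β p|⁻¹ * |∑ j, β j * blockLift d B r j|) := by gcongr
      _ = |∑ j, β j * blockLift d B r j| := by field_simp
      _ ≤ t := ht r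

/-- A relation `∑ y h • b_h = 0` between columns, multiplied symmetrically by `e` copies of
`b_{h₀}`, becomes a relation between lifted columns. Its coefficient at the constant tuple `h₀` is
`y h₀`, which must therefore vanish. -/
theorem finrank_colSpan_eq (hτ : 0 < τ)
    (hB : ∀ c₀, ∀ c : Fin s × NondecTuple (e + 1) m → ℝ, c c₀ = 1 →
      ∃ r, τ ≤ |∑ j, c j * blockLift (e + 1) B r j|) (i : Fin s) :
    Module.finrank ℝ (colSpan (B i)) = m := by
  have hli : LinearIndependent ℝ fun h : Fin m => fun t : Fin n => B i t h := by
    rw [Fintype.linearIndependent_iff]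
    intro y hy h₀
    have hy' : ∀ t, ∑ h, y h * B i t h = 0 := fun t => by
      simpa using congrFun hy t
    let g : Fin m → Fin (e + 1) → Fin m := fun h => Function.update (fun _ => h₀) 0 h
    have hsum : ∀ r : Fin (e + 1) → Fin n, ∑ h, y h * symKronTuple (B i) r (g h) = 0 := by
      intro r
      have h1 : ∀ h, y h * symKronTuple (B i) r (g h) =
          ∑ π : Equiv.Perm (Fin (e + 1)), 1 / ((e + 1).factorial : ℝ) *
            ((∏ j ∈ Finset.univ.erase (π.symm 0), B i (r j) h₀) *
              (y h * B i (r (π.symm 0)) h)) := by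
        intro h
        rw [symKronTuple, Finset.mul_sum, Finset.mul_sum]
        refine Finset.sum_congr rfl fun π _ => ?_
        rw [← Finset.mul_prod_erase _ _ (Finset.mem_univ (π.symm 0))]
        have h2 : ∏ j ∈ Finset.univ.erase (π.symm 0), B i (r j) (g h (π j)) =
            ∏ j ∈ Finset.univ.erase (π.symm 0), B i (r j) h₀ := by
          refine Finset.prod_congr rfl fun j hj => ?_
          have hne : π j ≠ 0 := fun h0 => (Finset.mem_erase.1 hj).1 (by rw [← h0]; simp)
          simp [g, hne]
        rw [h2]
        simp only [g, Equiv.apply_symm_apply, Function.update_self]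
        ring
      simp only [h1]
      rw [Finset.sum_comm]
      refine Finset.sum_eq_zero fun π _ => ?_
      rw [← Finset.mul_sum, ← Finset.mul_sum, hy', mul_zero, mul_zero]
    let k₀ : NondecTuple (e + 1) m := ⟨fun _ => h₀, fun _ _ _ => le_rfl⟩
    let β : Fin s × NondecTuple (e + 1) m → ℝ := fun p =>
      if p.1 = i then ∑ h with sortTuple (g h) = p.2, y h else 0
    have hβ0 : ∀ r, ∑ p, β p * blockLift (e + 1) B r p = 0 := by
      intro r
      rw [Fintype.sum_prod_type, Finset.sum_eq_single i]
      · simp only [β, if_true, blockLift, Matrix.of_apply]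
        rw [← sum_mul_symKronTuple, hsum]
      · intro i' _ hi'
        exact Finset.sum_eq_zero fun k _ => by simp [β, hi']
      · simp
    have h3 := abs_coeff_mul_le hB (β := β) (t := 0) (fun r => by simp [hβ0 r]) le_rfl (i, k₀)
    have h4 : β (i, k₀) = y h₀ := by
      simp only [β, if_true]
      rw [Finset.sum_eq_single_of_mem h₀]
      · refine Finset.mem_filter.2 ⟨Finset.mem_univ _, ?_⟩
        have : g h₀ = k₀.1 := by
          funext b
          simp only [g, k₀, Function.update_apply]
          split_ifs <;> rfl
        rw [this, sortTuple_val]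
      · intro h hh hne
        exfalso
        have h5 := congrArg Subtype.val (Finset.mem_filter.1 hh).2
        have h6 := congrFun h5 ((Tuple.sort (g h)).symm 0)
        simp [sortTuple, g, k₀] at h6
        exact hne h6
    rw [h4] at h3
    have h7 : |y h₀| ≤ 0 := by
      by_contra hcon
      have := mul_pos (not_le.1 hcon) hτ
      linarith
    exact abs_nonpos_iff.1 h7
  rw [colSpan, finrank_span_eq_card hli, Fintype.card_fin]

theorem exists_mul_eq_of_colSpan_eq {V U : Matrix (Fin n) (Fin m) ℝ} (h : colSpan V = colSpan U) :
    ∃ R : Matrix (Fin m) (Fin m) ℝ, V = U * R := by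
  have h1 : ∀ k, ∃ c : Fin m → ℝ, ∑ h, c h • (fun t => U t h) = fun t => V t k := by
    intro k
    rw [← Submodule.mem_span_range_iff_exists_fun]
    change _ ∈ colSpan U
    rw [← h]
    exact Submodule.subset_span ⟨k, rfl⟩
  choose c hc using h1
  refine ⟨Matrix.of fun h k => c k h, ?_⟩
  ext t k
  rw [← congrFun (hc k) t, Matrix.mul_apply]
  simp [mul_comm]

/-- Writing `V i = B i * R i` turns coefficients `α` for `V` into coefficients `β` for `B`. The
bound on `β` bounds the tensor contributed by each block, and pairing with products of columns of `V
i` recovers `α`; the size of `R` never enters. The three factors `n ^ d` come from summing over the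
columns of a block, over tensor coordinates, and over all columns. -/
theorem le_leastSingularValue_blockLift {d : ℕ} (hs : 1 ≤ s) (hm : 1 ≤ m) (hmn : m ≤ n)
    (hτ : 0 < τ) (hB : ∀ c₀, ∀ c : Fin s × NondecTuple d m → ℝ, c c₀ = 1 →
      ∃ r, τ ≤ |∑ j, c j * blockLift d B r j|)
    {Y : ℝ} (hY : ∀ i t h, |B i t h| ≤ Y) (hY0 : 0 < Y)
    (hcard : s * Fintype.card (NondecTuple d m) ≤ n ^ d)
    {V : Fin s → Matrix (Fin n) (Fin m) ℝ} (hV : ∀ i, IsOrthonormalBasisOf (V i) (colSpan (B i))) :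
    τ / (d.factorial * Y ^ d * (n : ℝ) ^ (3 * d)) ≤ leastSingularValue (blockLift d V) := by
  have hn : (0 : ℝ) < n := by exact_mod_cast (by omega : 0 < n)
  have : Nonempty (Fin s × NondecTuple d m) :=
    ⟨(⟨0, hs⟩, ⟨fun _ => ⟨0, hm⟩, fun _ _ _ => le_rfl⟩)⟩
  refine le_leastSingularValue fun α => ?_
  set M := blockLift d V with hM
  set t := ‖M.toEuclideanLin α‖ with ht
  have hMα : ∀ r, (M.toEuclideanLin α) r = ∑ p, α p * M r p := fun r => by
    rw [Matrix.toLpLin_apply]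
    simp [Matrix.mulVec, dotProduct, mul_comm]
  have htr : ∀ r, |∑ p, α p * M r p| ≤ t := fun r => by
    rw [← hMα, ← Real.norm_eq_abs]
    exact PiLp.norm_apply_le _ r
  choose R hR using fun i => exists_mul_eq_of_colSpan_eq (hV i).2
  let β : Fin s × NondecTuple d m → ℝ := fun p =>
    ∑ x : NondecTuple d m × (Fin d → Fin m) with sortTuple x.2 = p.2,
      α (p.1, x.1) * ∏ b, R p.1 (x.2 b) (x.1.1 b)
  have hβ : ∀ i r, ∑ k, α (i, k) * symKronPow d (V i) r k =
      ∑ k, β (i, k) * symKronPow d (B i) r k := by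
    intro i r
    rw [← sum_mul_symKronTuple (B i) r
      (fun x : NondecTuple d m × (Fin d → Fin m) => α (i, x.1) * ∏ b, R i (x.2 b) (x.1.1 b))
      (fun x => x.2), Fintype.sum_prod_type]
    refine Finset.sum_congr rfl fun k _ => ?_
    conv_lhs => rw [hR i, symKronPow_mul, Finset.mul_sum]
    exact Finset.sum_congr rfl fun g _ => by ring
  have hβt : ∀ p, |β p| * τ ≤ t := abs_coeff_mul_le hB (fun r => by
    have : ∑ j, β j * blockLift d B r j = ∑ p, α p * M r p := by
      rw [Fintype.sum_prod_type, Fintype.sum_prod_type]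
      exact Finset.sum_congr rfl fun i _ => (hβ i r).symm
    rw [this]
    exact htr r) (norm_nonneg _)
  have hT : ∀ i r, |∑ k, α (i, k) * symKronPow d (V i) r k| ≤ (n : ℝ) ^ d * (t / τ * Y ^ d) := by
    intro i r
    rw [hβ]
    calc _ ≤ ∑ k : NondecTuple d m, |β (i, k) * symKronPow d (B i) r k| :=
          Finset.abs_sum_le_sum_abs _ _
      _ ≤ ∑ _k : NondecTuple d m, t / τ * Y ^ d := Finset.sum_le_sum fun k _ => by
          rw [abs_mul]
          exact mul_le_mul ((le_div_iff₀ hτ).2 (hβt _)) (abs_symKronPow_le (hY i) r k)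
            (abs_nonneg _) (div_nonneg (norm_nonneg _) hτ.le)
      _ = Fintype.card (NondecTuple d m) * (t / τ * Y ^ d) := by simp
      _ ≤ _ := by
          have h1 : Fintype.card (NondecTuple d m) ≤ n ^ d :=
            (Nat.le_mul_of_pos_left _ hs).trans hcard
          have h2 : (Fintype.card (NondecTuple d m) : ℝ) ≤ (n : ℝ) ^ d := by exact_mod_cast h1
          have h3 : 0 ≤ t := norm_nonneg _
          gcongr
  have hα : ∀ p, |α p| ≤ d.factorial * ((n : ℝ) ^ d * ((n : ℝ) ^ d * (t / τ * Y ^ d))) := by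
    rintro ⟨i, k⟩
    have h1 : ∑ r : Fin d → Fin n, (∏ b, V i (r b) (k.1 b)) *
        ∑ k', α (i, k') * symKronPow d (V i) r k' = α (i, k) * (1 / (d.factorial : ℝ) *
          ((Finset.univ.filter fun π : Equiv.Perm (Fin d) => k.1 ∘ π = k.1).card : ℝ)) := by
      have h2 : ∑ r : Fin d → Fin n, (∏ b, V i (r b) (k.1 b)) *
          ∑ k', α (i, k') * symKronPow d (V i) r k' = ∑ k', α (i, k') *
            ∑ r : Fin d → Fin n, (∏ b, V i (r b) (k.1 b)) * symKronPow d (V i) r k' := by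
        simp only [Finset.mul_sum]
        rw [Finset.sum_comm]
        exact Finset.sum_congr rfl fun k' _ => Finset.sum_congr rfl fun r _ => by ring
      rw [h2]
      simp only [sum_prod_mul_symKronPow (hV i).1]
      simp
    have hc1 : (1 : ℝ) ≤
        ((Finset.univ.filter fun π : Equiv.Perm (Fin d) => k.1 ∘ π = k.1).card : ℝ) := by
      rw [Nat.one_le_cast]
      exact Finset.card_pos.2 ⟨1, by simp⟩
    have h3 : |α (i, k)| * (1 / (d.factorial : ℝ)) ≤
        (n : ℝ) ^ d * ((n : ℝ) ^ d * (t / τ * Y ^ d)) := by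
      calc |α (i, k)| * (1 / (d.factorial : ℝ)) ≤ |α (i, k)| * (1 / (d.factorial : ℝ) *
          ((Finset.univ.filter fun π : Equiv.Perm (Fin d) => k.1 ∘ π = k.1).card : ℝ)) := by
            gcongr
            exact le_mul_of_one_le_right (by positivity) hc1
        _ = |∑ r : Fin d → Fin n, (∏ b, V i (r b) (k.1 b)) *
              ∑ k', α (i, k') * symKronPow d (V i) r k'| := by
            rw [h1, abs_mul]
            congr 1
            exact (abs_of_nonneg (by positivity)).symm
        _ ≤ ∑ r : Fin d → Fin n, |(∏ b, V i (r b) (k.1 b)) *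
              ∑ k', α (i, k') * symKronPow d (V i) r k'| := Finset.abs_sum_le_sum_abs _ _
        _ ≤ ∑ _r : Fin d → Fin n, (n : ℝ) ^ d * (t / τ * Y ^ d) :=
            Finset.sum_le_sum fun r _ => by
              rw [abs_mul]
              refine (mul_le_of_le_one_left (abs_nonneg _) ?_).trans (hT i r)
              rw [Finset.abs_prod]
              exact Finset.prod_le_one (fun _ _ => abs_nonneg _)
                fun b _ => abs_le_one_of_transpose_mul_self (hV i).1 _ _
        _ = _ := by simp
    rw [mul_one_div, div_le_iff₀ (by positivity)] at h3
    linarith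
  have hnorm : ‖α‖ ≤ (n : ℝ) ^ d * (d.factorial * ((n : ℝ) ^ d * ((n : ℝ) ^ d * (t / τ * Y ^ d)))) := by
    calc ‖α‖ ≤ ∑ p, ‖α p‖ := by
          have h1 : ∀ x : EuclideanSpace ℝ (Fin s × NondecTuple d m),
              x = ∑ p, x p • EuclideanSpace.single p (1 : ℝ) := by
            intro x
            ext p
            simp [Pi.single_apply]
          conv_lhs => rw [h1 α]
          refine (norm_sum_le _ _).trans (Finset.sum_le_sum fun p _ => ?_)
          rw [norm_smul]
          simp
      _ ≤ ∑ _p : Fin s × NondecTuple d m,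
            d.factorial * ((n : ℝ) ^ d * ((n : ℝ) ^ d * (t / τ * Y ^ d))) :=
          Finset.sum_le_sum fun p _ => by rw [Real.norm_eq_abs]; exact hα p
      _ = ((s * Fintype.card (NondecTuple d m) : ℕ) : ℝ) *
            (d.factorial * ((n : ℝ) ^ d * ((n : ℝ) ^ d * (t / τ * Y ^ d)))) := by
          simp
      _ ≤ _ := by
          have h2 : ((s * Fintype.card (NondecTuple d m) : ℕ) : ℝ) ≤ (n : ℝ) ^ d := by
            exact_mod_cast hcard
          have h3 : 0 ≤ t := norm_nonneg _
          gcongr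
  calc τ / (d.factorial * Y ^ d * (n : ℝ) ^ (3 * d)) * ‖α‖
      ≤ τ / (d.factorial * Y ^ d * (n : ℝ) ^ (3 * d)) *
        ((n : ℝ) ^ d * (d.factorial * ((n : ℝ) ^ d * ((n : ℝ) ^ d * (t / τ * Y ^ d))))) := by gcongr
    _ = t := by
        have : (n : ℝ) ^ (3 * d) = (n : ℝ) ^ d * (n : ℝ) ^ d * (n : ℝ) ^ d := by ring
        rw [this]
        field_simp

end Deterministic

/-! ### Gaussian estimates and the product measure -/

theorem gaussianReal_Icc_le {v : NNReal} (hv : v ≠ 0) (μ z : ℝ) :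
    gaussianReal 0 v (Set.Icc (z - μ) (z + μ)) ≤ ENNReal.ofReal (2 * μ / √v) := by
  have hv0 : (0 : ℝ) < v := by exact_mod_cast pos_iff_ne_zero.2 hv
  have hpdf : ∀ x, gaussianPDF 0 v x ≤ ENNReal.ofReal (1 / √v) := by
    intro x
    refine ENNReal.ofReal_le_ofReal ?_
    rw [gaussianPDFReal, one_div]
    have h1 : √(v : ℝ) ≤ √(2 * Real.pi * v) := by
      apply Real.sqrt_le_sqrt
      have := Real.pi_gt_three
      nlinarith
    have h2 : Real.exp (-(x - 0) ^ 2 / (2 * v)) ≤ 1 := by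
      rw [Real.exp_le_one_iff]
      apply div_nonpos_of_nonpos_of_nonneg
      · nlinarith [sq_nonneg (x - 0)]
      · positivity
    calc _ ≤ (√(2 * Real.pi * v))⁻¹ * 1 := by gcongr
      _ ≤ _ := by
        rw [mul_one]
        exact inv_anti₀ (Real.sqrt_pos.2 hv0) h1
  rw [gaussianReal_apply 0 hv]
  calc _ ≤ ∫⁻ _ in Set.Icc (z - μ) (z + μ), ENNReal.ofReal (1 / √v) :=
        lintegral_mono fun x => hpdf x
    _ = ENNReal.ofReal (1 / √v) * ENNReal.ofReal (2 * μ) := by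
        rw [lintegral_const, Measure.restrict_apply_univ, Real.volume_Icc]
        congr 2
        ring
    _ = _ := by
        rw [← ENNReal.ofReal_mul (by positivity)]
        congr 1
        ring

theorem gaussianReal_abs_gt_le {v : NNReal} (hv : v ≠ 0) {a : ℝ} (ha : 0 ≤ a) :
    gaussianReal 0 v {x | a < |x|} ≤ ENNReal.ofReal (2 * Real.exp (-(a ^ 2 / (2 * v)))) := by
  have hv0 : (0 : ℝ) < v := by exact_mod_cast pos_iff_ne_zero.2 hv
  have hmgf : ∀ t, mgf id (gaussianReal 0 v) t = Real.exp (v * t ^ 2 / 2) := fun t => by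
    rw [mgf_id_gaussianReal]; simp
  have h1 : (gaussianReal 0 v).real {x | a ≤ id x} ≤ Real.exp (-(a ^ 2 / (2 * v))) := by
    refine (measure_ge_le_exp_mul_mgf a (t := a / v) (by positivity)
      (integrable_exp_mul_gaussianReal _)).trans_eq ?_
    change _ * mgf id _ _ = _
    rw [hmgf, ← Real.exp_add]
    congr 1
    field_simp
    ring
  have h2 : (gaussianReal 0 v).real {x | id x ≤ -a} ≤ Real.exp (-(a ^ 2 / (2 * v))) := by
    refine (measure_le_le_exp_mul_mgf (-a) (t := -(a / v))
      (neg_nonpos.2 (by positivity)) (integrable_exp_mul_gaussianReal _)).trans_eq ?_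
    change _ * mgf id _ _ = _
    rw [hmgf, ← Real.exp_add]
    congr 1
    field_simp
    ring
  have hsub : {x : ℝ | a < |x|} ⊆ {x | a ≤ id x} ∪ {x | id x ≤ -a} := by
    intro x hx
    rcases lt_abs.1 (show a < |x| from hx) with h | h
    · exact Or.inl h.le
    · exact Or.inr (by change x ≤ -a; linarith)
  calc _ ≤ gaussianReal 0 v ({x | a ≤ id x} ∪ {x | id x ≤ -a}) := measure_mono hsub
    _ ≤ _ := measure_union_le _ _
    _ ≤ ENNReal.ofReal (Real.exp (-(a ^ 2 / (2 * v)))) +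
        ENNReal.ofReal (Real.exp (-(a ^ 2 / (2 * v)))) := by
        rw [← ofReal_measureReal, ← ofReal_measureReal]
        exact add_le_add (ENNReal.ofReal_le_ofReal h1) (ENNReal.ofReal_le_ofReal h2)
    _ = _ := by
        rw [← ENNReal.ofReal_add (by positivity) (by positivity)]
        congr 1
        ring

/-- Flattening the indices makes the coordinatewise resampling arguments applicable. -/
theorem map_uncurry_gaussianBlocks (s n m : ℕ) (ρ : ℝ) :
    (gaussianBlocks s n m ρ).map (fun G (c : Fin s × Fin n × Fin m) => G c.1 c.2.1 c.2.2) =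
      Measure.pi fun _ => gaussianReal 0 (Real.toNNReal (ρ ^ 2 / n)) := by
  set ν := gaussianReal 0 (Real.toNNReal (ρ ^ 2 / n)) with hν
  have hcurry : ∀ (ι κ : Type) [Fintype ι] [Fintype κ],
      (Measure.pi fun _ : ι => Measure.pi fun _ : κ => ν).map (fun G (c : ι × κ) => G c.1 c.2) =
        Measure.pi fun _ => ν := by
    intro ι κ _ _
    have h := Measure.infinitePi_map_curry_symm (ι := ι) (κ := κ) fun _ _ => ν
    simp only [Measure.infinitePi_eq_pi] at h
    exact h
  have h1 : (gaussianBlocks s n m ρ).map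
      (fun G (i : Fin s) (c : Fin n × Fin m) => G i c.1 c.2) =
        Measure.pi fun _ : Fin s => Measure.pi fun _ : Fin n × Fin m => ν := by
    unfold gaussianBlocks
    rw [← hcurry (Fin n) (Fin m)]
    exact Measure.pi_map_pi fun i => (by fun_prop : Measurable fun (G : Fin n → Fin m → ℝ)
      (c : Fin n × Fin m) => G c.1 c.2).aemeasurable
  rw [← hcurry (Fin s) (Fin n × Fin m), ← h1, Measure.map_map (by fun_prop) (by fun_prop)]
  rfl

theorem colSpan_smul {n m : ℕ} {a : ℝ} (ha : a ≠ 0) (A : Matrix (Fin n) (Fin m) ℝ) :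
    colSpan (a • A) = colSpan A := by
  unfold colSpan
  apply le_antisymm
  · rw [Submodule.span_le]
    rintro _ ⟨j, rfl⟩
    have := Submodule.smul_mem _ a (Submodule.subset_span (R := ℝ)
      (Set.mem_range_self (f := fun j : Fin m => fun i : Fin n => A i j) j))
    exact this
  · rw [Submodule.span_le]
    rintro _ ⟨j, rfl⟩
    have := Submodule.smul_mem _ a⁻¹ (Submodule.subset_span (R := ℝ)
      (Set.mem_range_self (f := fun j : Fin m => fun i : Fin n => (a • A) i j) j))
    rwa [show (a⁻¹ • fun i => (a • A) i j) = fun i => A i j by funext i; simp [ha]] at this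

theorem card_nondecTuple_le (d n : ℕ) : Fintype.card (NondecTuple d n) ≤ n ^ d :=
  (Fintype.card_subtype_le _).trans_eq (by simp)

/-- Good values of the perturbation: the conclusion of the theorem holds outside the events that an
entry is large or that a column is nearly dependent on the others. -/
theorem finrank_and_le_of_not_nearDependent {s n m e : ℕ} (hs : 1 ≤ s) (hm : 1 ≤ m) (hmn : m ≤ n)
    (hcard : s * Fintype.card (NondecTuple (e + 1) m) ≤ n ^ (e + 1))
    {P : Fin s → Matrix (Fin n) (Fin m) ℝ} (hP : ∀ i t h, |P i t h| ≤ 1) {lam K τ : ℝ}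
    (hlam : 0 < lam) (hlam1 : lam ≤ 1) (hK : 0 ≤ K) (hτ : 0 < τ)
    {z : Fin s × Fin n × Fin m → ℝ} (hz : ∀ c, |z c| ≤ K / lam)
    (hbad : ∀ c₀, z ∉ nearDependent (e + 1) P lam τ c₀) :
    (∀ i, Module.finrank ℝ (colSpan (P i + Matrix.of fun t h => z (i, t, h))) = m) ∧
      ∀ V : Fin s → Matrix (Fin n) (Fin m) ℝ,
        (∀ i, IsOrthonormalBasisOf (V i) (colSpan (P i + Matrix.of fun t h => z (i, t, h)))) →
        τ / ((e + 1).factorial * (1 + K) ^ (e + 1) * (n : ℝ) ^ (3 * (e + 1))) ≤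
          leastSingularValue (blockLift (e + 1) V) := by
  have hspan : ∀ i, colSpan (P i + Matrix.of fun t h => z (i, t, h)) =
      colSpan (scaledBlocks P lam z i) := fun i => (colSpan_smul hlam.ne' _).symm
  have hB : ∀ c₀, ∀ c : Fin s × NondecTuple (e + 1) m → ℝ, c c₀ = 1 →
      ∃ r, τ ≤ |∑ j, c j * blockLift (e + 1) (scaledBlocks P lam z) r j| := by
    intro c₀ c hc
    by_contra hcon
    push Not at hcon
    exact hbad c₀ ⟨c, hc, hcon⟩
  refine ⟨fun i => by rw [hspan]; exact finrank_colSpan_eq hτ hB i, fun V hV =>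
    le_leastSingularValue_blockLift hs hm hmn hτ hB (fun i t h => ?_) (by linarith) hcard
      fun i => by rw [← hspan]; exact hV i⟩
  simp only [scaledBlocks, Matrix.of_apply]
  rw [abs_mul, abs_of_pos hlam]
  calc lam * |P i t h + z (i, t, h)| ≤ lam * (1 + K / lam) := by
        gcongr
        exact (abs_add_le _ _).trans (add_le_add (hP _ _ _) (hz _))
    _ = lam + K := by field_simp
    _ ≤ 1 + K := by gcongr

/-! ### Dimension count and numerical bounds -/

/-- The dimension count behind the choice of the forms. -/
theorem dimension_count {s n m e q D₀ : ℕ} {η : ℝ} (hη : 0 < η) (hn : 1 ≤ n)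
    (hs : (s : ℝ) * ((m + (e + 1) - 1).choose (e + 1) : ℝ) ≤
      (1 - η) * ((n + (e + 1) - 1).choose (e + 1) : ℝ))
    (hm : (m : ℝ) * (4 * D₀ * (e + 1) ^ 2) ≤ η * n) (hD₀ : 1 ≤ D₀)
    (hq : (q : ℝ) * (4 * D₀ * (e + 1) ^ 2) ≤ η * n) :
    s * Fintype.card (NondecTuple (e + 1) m) +
      (m + q * D₀ * (e + 1)) * Fintype.card (NondecTuple e n) <
        Fintype.card (NondecTuple (e + 1) n) := by
  rw [card_nondecTuple, card_nondecTuple, card_nondecTuple]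
  obtain ⟨k, rfl⟩ : ∃ k, n = k + 1 := ⟨n - 1, by omega⟩
  -- Vanishing on one vector costs the fraction `(e + 1) / (n + e)` of the dimension, so order `n`
  -- vectors fit into the spare fraction `η`.
  have hid := Nat.add_one_mul_choose_eq (k + e) e
  have e1 : k + 1 + e - 1 = k + e := by omega
  have e2 : k + 1 + (e + 1) - 1 = k + e + 1 := by omega
  rw [e1, e2]
  rw [e2] at hs
  set N : ℕ := (k + e + 1).choose (e + 1) with hN
  set N' : ℕ := (k + e).choose e with hN'
  have hN'pos : (0 : ℝ) < N' := by exact_mod_cast Nat.choose_pos (by omega)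
  have hidR : ((k : ℝ) + e + 1) * N' = N * (e + 1) := by exact_mod_cast hid
  have hDr : (1 : ℝ) ≤ D₀ := by exact_mod_cast hD₀
  have he : (0 : ℝ) ≤ e := Nat.cast_nonneg e
  have hmr : (0 : ℝ) ≤ m := Nat.cast_nonneg m
  have hqr : (0 : ℝ) ≤ q := Nat.cast_nonneg q
  have hm1 : (m : ℝ) * (e + 1) * 4 ≤ η * (k + 1 : ℕ) := by
    refine le_trans ?_ hm
    have : (e + 1 : ℝ) ≤ D₀ * (e + 1) ^ 2 := by nlinarith
    nlinarith
  have hkey : ((m : ℝ) + q * D₀ * (e + 1)) * (e + 1) * 2 ≤ η * (k + 1) := by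
    push_cast at hm1 hq
    nlinarith
  have hlt : ((m : ℝ) + q * D₀ * (e + 1)) * N' < η * N := by
    have h1 : ((m : ℝ) + q * D₀ * (e + 1)) * N' * (e + 1) < η * N * (e + 1) := by
      have hk : (0 : ℝ) ≤ k := Nat.cast_nonneg k
      have h2 : ((m : ℝ) + q * D₀ * (e + 1)) * (e + 1) < η * (k + e + 1) := by
        have : 0 < η * (k + 1) := by positivity
        have h3 : 0 ≤ η * e := by positivity
        nlinarith
      calc _ = ((m : ℝ) + q * D₀ * (e + 1)) * (e + 1) * N' := by ring
        _ < η * (k + e + 1) * N' := by gcongr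
        _ = η * ((k + e + 1) * N') := by ring
        _ = η * N * (e + 1) := by rw [hidR]; ring
    exact lt_of_mul_lt_mul_right h1 (by positivity)
  have : (s : ℝ) * ((m + (e + 1) - 1).choose (e + 1) : ℝ) + ((m : ℝ) + q * D₀ * (e + 1)) * N' <
      N := by linarith
  exact_mod_cast this

/-- The number of entries is absorbed by `n ^ k ≤ k! * exp n`, and the factor `k!` in turn by the
exponent. -/
theorem tail_sum_le {n k N : ℕ} (hn : 1 ≤ n) (hN : N ≤ n ^ k) :
    (N : ℝ) * (2 * Real.exp (-(((k.factorial : ℝ) + 4) ^ 2 * n / 2))) ≤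
      2 * Real.exp (-(3 * n)) := by
  set f : ℝ := (k.factorial : ℝ) with hf
  have hf0 : 0 < f := by positivity
  have hn1 : (1 : ℝ) ≤ n := by exact_mod_cast hn
  have h1 : (N : ℝ) ≤ f * Real.exp n := by
    have h2 := Real.pow_div_factorial_le_exp (n : ℝ) (by positivity) k
    rw [div_le_iff₀ (by positivity)] at h2
    calc (N : ℝ) ≤ (n : ℝ) ^ k := by exact_mod_cast hN
      _ ≤ _ := by rw [mul_comm]; exact h2
  have h3 : f ≤ Real.exp f := by linarith [Real.add_one_le_exp f]
  have h4 : Real.exp (-((f + 4) ^ 2 * n / 2)) ≤ Real.exp (-f - n - 3 * n) := by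
    apply Real.exp_le_exp.2
    nlinarith [mul_nonneg hf0.le (by linarith : (0 : ℝ) ≤ n - 1), sq_nonneg f]
  calc _ ≤ (f * Real.exp n) * (2 * Real.exp (-f - n - 3 * n)) := by gcongr
    _ ≤ (Real.exp f * Real.exp n) * (2 * Real.exp (-f - n - 3 * n)) := by gcongr
    _ = 2 * (Real.exp f * Real.exp n * Real.exp (-f - n - 3 * n)) := by ring
    _ = _ := by
        rw [← Real.exp_add, ← Real.exp_add]
        congr 2
        ring

theorem column_sum_le {n d N q : ℕ} (hn : 1 ≤ n) (hN : N ≤ n ^ d) (hq : 1 ≤ q) :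
    (N : ℝ) * (Real.exp (-3) / (n : ℝ) ^ d) ^ q ≤ Real.exp (-(3 * q)) := by
  have hn1 : (1 : ℝ) ≤ n := by exact_mod_cast hn
  have h1 : (N : ℝ) ≤ ((n : ℝ) ^ d) ^ q := by
    calc (N : ℝ) ≤ (n : ℝ) ^ d := by exact_mod_cast hN
      _ ≤ _ := le_self_pow₀ (one_le_pow₀ hn1) (by omega)
  rw [div_pow, ← Real.exp_nat_mul]
  calc (N : ℝ) * (Real.exp (q * -3) / ((n : ℝ) ^ d) ^ q) ≤
        ((n : ℝ) ^ d) ^ q * (Real.exp (q * -3) / ((n : ℝ) ^ d) ^ q) := by gcongr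
    _ = _ := by
        rw [mul_div_cancel₀ _ (by positivity)]
        congr 1
        ring

theorem exp_sum_le {c n q : ℝ} (hc : c ≤ 1) (hn : 1 ≤ n) (hq : 1 ≤ q) (hcq : c * n ≤ q) :
    Real.exp (-(3 * q)) + 2 * Real.exp (-(3 * n)) ≤ Real.exp (-(c * n)) := by
  have h2 : (3 : ℝ) * Real.exp (-2) ≤ 1 := by
    have := Real.add_one_le_exp (2 : ℝ)
    rw [Real.exp_neg, mul_inv_le_iff₀ (Real.exp_pos _)]
    linarith
  have h3 : Real.exp (-(3 * q)) ≤ Real.exp (-2) * Real.exp (-(c * n)) := by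
    rw [← Real.exp_add]
    apply Real.exp_le_exp.2
    linarith
  have h4 : Real.exp (-(3 * n)) ≤ Real.exp (-2) * Real.exp (-(c * n)) := by
    rw [← Real.exp_add]
    apply Real.exp_le_exp.2
    nlinarith
  have := Real.exp_pos (-(c * n))
  nlinarith

/-- The lower bound is polynomial in `min ρ 1 / n`. -/
theorem threshold_ge {n ρ h a b K g g' : ℝ} {d D L : ℕ} (hn : 1 ≤ n) (hρ : 0 < ρ) (hh : 0 < h)
    (ha : 0 < a) (hb : 0 < b) (hK : 0 ≤ K) (hg : 0 < g) (hg' : 0 < g') :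
    h * (a / (4 * b)) ^ L / (2 * g * (1 + K) ^ (d * D) * (g' * (1 + K) ^ d)) *
        (min ρ 1 / n) ^ ((d + 1) * L + d * D + 4 * d) ≤
      h * (a * ρ / n ^ (d + 1) / (4 * (b * max ρ 1))) ^ L /
          (2 * (n ^ d * (g * (n ^ d * (1 + K) ^ d) ^ D))) /
        (g' * (1 + K) ^ d * n ^ (3 * d)) := by
  have hmin : 0 < min ρ 1 := lt_min hρ one_pos
  have hmax : 0 < max ρ 1 := lt_max_of_lt_left hρ
  have hquot : ρ / max ρ 1 = min ρ 1 := by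
    rw [div_eq_iff hmax.ne', min_mul_max, mul_one]
  have h1 : a * ρ / n ^ (d + 1) / (4 * (b * max ρ 1)) =
      a / (4 * b) * (min ρ 1 / n ^ (d + 1)) := by
    rw [← hquot]
    field_simp
  have hn0 : 0 < n := by linarith
  have h2 : (min ρ 1 / n) ^ ((d + 1) * L + d * D + 4 * d) ≤
      (min ρ 1 / n ^ (d + 1)) ^ L * (1 / n ^ (d * D + 4 * d)) := by
    rw [div_pow, div_pow, ← pow_mul, div_mul_div_comm, mul_one, ← pow_add, ← add_assoc]
    refine div_le_div_of_nonneg_right ?_ (by positivity)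
    refine pow_le_pow_of_le_one hmin.le (min_le_right _ _) ?_
    have : L ≤ (d + 1) * L := Nat.le_mul_of_pos_left _ (Nat.succ_pos _)
    omega
  rw [h1, mul_pow]
  have hA : 0 < (1 + K) := by linarith
  calc _ ≤ h * (a / (4 * b)) ^ L / (2 * g * (1 + K) ^ (d * D) * (g' * (1 + K) ^ d)) *
        ((min ρ 1 / n ^ (d + 1)) ^ L * (1 / n ^ (d * D + 4 * d))) := by gcongr
    _ = _ := by
        have e1 : n ^ (d * D + 4 * d) = n ^ d * (n ^ d) ^ D * n ^ (3 * d) := by ring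
        have e2 : (n ^ d * (1 + K) ^ d) ^ D = (n ^ d) ^ D * (1 + K) ^ (d * D) := by
          rw [mul_pow, ← pow_mul (1 + K)]
        rw [e1, e2]
        field_simp

/-! ### Choice of parameters and conclusion -/

set_option maxHeartbeats 1000000 in
theorem mainTheorem11 (d : ℕ) (hd : 1 ≤ d) :
    ∃ c_d : ℝ, 0 < c_d ∧ ∃ A : ℕ, ∀ δ : ℝ, 0 < δ →
      ∃ κ : ℝ, 0 < κ ∧ ∃ c : ℝ, 0 < c ∧
        ∀ n m s : ℕ, 1 ≤ m → m < n → 1 ≤ s →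
          (s : ℝ) * ((m + d - 1).choose d : ℝ) ≤ δ * ((n + d - 1).choose d : ℝ) →
          (m : ℝ) ≤ (1 - δ) * c_d * (n : ℝ) →
          ∀ ρ : ℝ, 0 < ρ →
          ∀ P : Fin s → Matrix (Fin n) (Fin m) ℝ, (∀ i, (P i)ᵀ * P i = 1) →
            gaussianBlocks s n m ρ
              {G | ¬ ((∀ i, Module.finrank ℝ (colSpan (P i + Matrix.of (G i))) = m) ∧
                ∀ V : Fin s → Matrix (Fin n) (Fin m) ℝ,
                  (∀ i, IsOrthonormalBasisOf (V i) (colSpan (P i + Matrix.of (G i)))) →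
                  κ * (min ρ 1 / (n : ℝ)) ^ A ≤ leastSingularValue (blockLift d V))}
              ≤ ENNReal.ofReal (Real.exp (-(c * (n : ℝ)))) := by
  obtain ⟨e, rfl⟩ : ∃ e, d = e + 1 := ⟨d - 1, by omega⟩
  set D₀ : ℕ := (e + 1) ^ (e + 1) with hD₀
  have hD₀1 : 1 ≤ D₀ := Nat.one_le_pow _ _ (Nat.succ_pos _)
  have hD₀r : (1 : ℝ) ≤ D₀ := by exact_mod_cast hD₀1
  -- Tail cutoff in units of `max ρ 1`; the union bound runs over at most `n ^ (e + 3)` entries.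
  set K : ℝ := ((e + 3).factorial : ℝ) + 4 with hK
  have hK0 : 0 < K := by positivity
  -- Large enough that the box of radius `b * max ρ 1` contains both the determinant witnesses and
  -- the truncated Gaussian entries.
  set b : ℝ := (e + 1 : ℕ) * D₀ + 1 + K with hb
  have hb0 : 0 < b := by positivity
  have hb1 : 1 ≤ b := by
    have : (0 : ℝ) ≤ (e + 1 : ℕ) * D₀ := by positivity
    linarith
  -- Chosen so that the failure probability `(D₀ * (e + 1)) ^ 2 * p₁` of one batch is exactly `exp
  -- (-3) / n ^ (e + 1)`.
  set ε : ℝ := Real.exp (-3) / (2 * ((D₀ * (e + 1) : ℕ) : ℝ) ^ 2) with hε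
  have hDe : (1 : ℝ) ≤ ((D₀ * (e + 1) : ℕ) : ℝ) := by
    exact_mod_cast Nat.mul_pos hD₀1 (Nat.succ_pos e)
  have hε0 : 0 < ε := by positivity
  have hε1 : ε ≤ 1 := by
    rw [hε, div_le_one (by positivity)]
    have := Real.exp_le_one_iff.2 (by norm_num : (-3 : ℝ) ≤ 0)
    nlinarith
  set L : ℕ := D₀ * (e + 1) * (D₀ * (e + 1)) with hL
  set g : ℝ := D₀ * D₀.factorial with hg
  have hg0 : 0 < g := by positivity
  set f : ℝ := ((2 ^ (e + 1))⁻¹ : ℝ) ^ D₀ with hf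
  have hf0 : 0 < f := by positivity
  clear_value D₀ K b ε
  have hcd : (0 : ℝ) < 1 / (4 * D₀ * (e + 1) ^ 2) := by positivity
  refine ⟨1 / (4 * D₀ * (e + 1) ^ 2), hcd,
    (e + 1 + 1) * L + (e + 1) * D₀ + 4 * (e + 1), fun δ hδ => ?_⟩
  -- For `δ ≥ 1` the hypotheses `1 ≤ m` and `m ≤ (1 - δ) * c_d * n` contradict each other.
  by_cases hδ1 : δ < 1
  swap
  · refine ⟨1, one_pos, 1, one_pos, fun n m s hm _ _ _ hmc => ?_⟩
    have hm' : (1 : ℝ) ≤ m := by exact_mod_cast hm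
    have : (1 - δ) * (1 / (4 * D₀ * (e + 1) ^ 2)) * (n : ℝ) ≤ 0 :=
      mul_nonpos_of_nonpos_of_nonneg
        (mul_nonpos_of_nonpos_of_nonneg (by linarith) hcd.le) (Nat.cast_nonneg n)
    linarith
  have hη : 0 < 1 - δ := by linarith
  refine ⟨f * (ε / (4 * b)) ^ L / (2 * g * (1 + K) ^ ((e + 1) * D₀) *
    ((e + 1).factorial * (1 + K) ^ (e + 1))), by positivity,
    (1 - δ) * (1 / (4 * D₀ * (e + 1) ^ 2)) / 2, by positivity, ?_⟩
  intro n m s hm hmn hs hsδ hmc ρ hρ P hP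
  have hn : 1 ≤ n := by omega
  have hn1 : (1 : ℝ) ≤ n := by exact_mod_cast hn
  have hm1 : (1 : ℝ) ≤ m := by exact_mod_cast hm
  set x : ℝ := (1 - δ) * (1 / (4 * D₀ * (e + 1) ^ 2)) * n with hx
  have hx1 : 1 ≤ x := hm1.trans hmc
  -- The number of batches has the same upper bound as `m`, and it is positive because `1 ≤ m ≤ x`.
  set q : ℕ := ⌊x⌋₊ with hq
  have hq1 : 1 ≤ q := Nat.one_le_floor_iff _ |>.2 hx1
  have hq1r : (1 : ℝ) ≤ q := by exact_mod_cast hq1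
  have hqx : (q : ℝ) ≤ x := Nat.floor_le (by linarith)
  have hxq : x < q + 1 := Nat.lt_floor_add_one x
  have hx4 : x * (4 * D₀ * (e + 1) ^ 2) = (1 - δ) * n := by
    rw [hx]; field_simp
  have hdim := dimension_count (s := s) (m := m) (q := q) (D₀ := D₀) hη hn
    (by rw [sub_sub_cancel]; exact hsδ)
    ((mul_le_mul_of_nonneg_right hmc (by positivity)).trans_eq hx4) hD₀1
    ((mul_le_mul_of_nonneg_right hqx (by positivity)).trans_eq hx4)
  have hcard : s * Fintype.card (NondecTuple (e + 1) m) ≤ n ^ (e + 1) :=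
    le_trans (by omega) (card_nondecTuple_le (e + 1) n)
  set M : ℝ := max ρ 1 with hM
  have hM1 : 1 ≤ M := le_max_right _ _
  have hρM : ρ ≤ M := le_max_left _ _
  -- The Gaussian density is at most `n / ρ`, so an interval of length `2 * μ` has mass at most `2 *
  -- ε / n ^ (e + 1)`.
  set μ : ℝ := ε * ρ / n ^ (e + 1 + 1) with hμ
  have hμ0 : 0 < μ := by positivity
  set v : NNReal := Real.toNNReal (ρ ^ 2 / n) with hv
  have hvr : (v : ℝ) = ρ ^ 2 / n := Real.coe_toNNReal _ (by positivity)
  have hv0 : v ≠ 0 := by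
    rw [← NNReal.coe_ne_zero, hvr]; positivity
  set p₁ : ENNReal := ENNReal.ofReal (2 * ε / n ^ (e + 1)) with hp₁
  have hp : ∀ z, gaussianReal 0 v (Set.Icc (z - μ) (z + μ)) ≤ p₁ := by
    intro z
    refine (gaussianReal_Icc_le hv0 μ z).trans (ENNReal.ofReal_le_ofReal ?_)
    have hsq : ρ / n ≤ √(v : ℝ) := by
      rw [hvr]
      apply Real.le_sqrt_of_sq_le
      rw [div_pow]
      gcongr
      nlinarith
    calc 2 * μ / √(v : ℝ) ≤ 2 * μ / (ρ / n) := by gcongr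
      _ = _ := by rw [hμ]; field_simp; ring
  set W : ℝ := b * M with hW
  have hμW : μ ≤ W := by
    calc μ ≤ ε * ρ / 1 := by rw [hμ]; gcongr; exact one_le_pow₀ hn1
      _ ≤ 1 * M := by rw [div_one]; gcongr
      _ ≤ b * M := mul_le_mul_of_nonneg_right hb1 (by linarith)
  -- Rescaling by `1 / max ρ 1` preserves the column spans and bounds the truncated entries by `1 +
  -- K` uniformly in `ρ`.
  have hlam : 0 < M⁻¹ := by positivity
  have hlam1 : M⁻¹ ≤ 1 := inv_le_one_of_one_le₀ hM1
  set E : ℝ := (n : ℝ) ^ (e + 1) * (1 + K) ^ (e + 1) with hE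
  have hE1 : 1 ≤ E := one_le_mul_of_one_le_of_one_le (one_le_pow₀ hn1) (one_le_pow₀ (by linarith))
  set κ : ℝ := f * (μ / (4 * W)) ^ L with hκ
  have hκ0 : 0 < κ := by positivity
  -- The factor `2` makes the determinant bound `κ / 2`, as a strict inequality is required.
  set τ : ℝ := κ / (2 * (n ^ (e + 1) * (g * E ^ D₀))) with hτ
  have hτ0 : 0 < τ := by positivity
  have hPle : ∀ i t h, |P i t h| ≤ 1 := fun i => abs_le_one_of_transpose_mul_self (hP i)
  have hKM : K / M⁻¹ = K * M := by rw [div_inv_eq_mul]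
  have hleaf : ∀ c₀, Measure.pi (fun _ : Fin s × Fin n × Fin m => gaussianReal 0 v)
      (nearDependent (e + 1) P M⁻¹ τ c₀ ∩ {z | ∀ c, |z c| ≤ K / M⁻¹}) ≤
        ENNReal.ofReal ((Real.exp (-3) / (n : ℝ) ^ (e + 1)) ^ q) := by
    rintro ⟨i₀, j₀⟩
    refine (measure_nearDependent_le hp hμ0 hμW hPle hlam hlam1 hD₀.ge ?_ ?_ le_rfl hE1 le_rfl ?_
      hdim i₀ j₀).trans_eq ?_
    · rw [div_inv_eq_mul, hW, hb]
      nlinarith [mul_nonneg hK0.le (by linarith : (0 : ℝ) ≤ M)]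
    · rw [hKM, hW, hb]
      gcongr
      have : (0 : ℝ) ≤ (e + 1 : ℕ) * D₀ := by positivity
      linarith
    · rw [← mul_assoc (D₀ : ℝ), hτ]
      change _ < κ
      calc _ = κ / 2 := by field_simp; exact hg.symm
        _ < κ := by linarith
    · rw [hp₁, ← ENNReal.ofReal_natCast, ← ENNReal.ofReal_mul (by positivity),
        ← ENNReal.ofReal_mul (by positivity), ← ENNReal.ofReal_pow (by positivity), hε]
      congr 2
      field_simp
  have htail : ∀ c : Fin s × Fin n × Fin m, Measure.pi (fun _ => gaussianReal 0 v)
      {z : Fin s × Fin n × Fin m → ℝ | K / M⁻¹ < |z c|} ≤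
        ENNReal.ofReal (2 * Real.exp (-(K ^ 2 * n / 2))) := by
    intro c
    have hmeas : MeasurableSet {y : ℝ | K / M⁻¹ < |y|} :=
      measurableSet_lt measurable_const (by fun_prop)
    have h1 : Measure.pi (fun _ : Fin s × Fin n × Fin m => gaussianReal 0 v)
        {z | K / M⁻¹ < |z c|} = gaussianReal 0 v {y | K / M⁻¹ < |y|} :=
      (measurePreserving_eval (fun _ : Fin s × Fin n × Fin m =>
        gaussianReal 0 v) c).measure_preimage hmeas.nullMeasurableSet
    rw [h1]
    refine (gaussianReal_abs_gt_le hv0 (by positivity)).trans (ENNReal.ofReal_le_ofReal ?_)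
    rw [hKM, hvr]
    refine mul_le_mul_of_nonneg_left (Real.exp_le_exp.2 (neg_le_neg ?_)) two_pos.le
    rw [le_div_iff₀ (by positivity)]
    calc K ^ 2 * n / 2 * (2 * (ρ ^ 2 / n)) = K ^ 2 * ρ ^ 2 := by field_simp
      _ ≤ (K * M) ^ 2 := by rw [mul_pow]; gcongr
  set U : Set (Fin s × Fin n × Fin m → ℝ) :=
    (⋃ c₀, nearDependent (e + 1) P M⁻¹ τ c₀ ∩ {z | ∀ c, |z c| ≤ K / M⁻¹}) ∪
      ⋃ c, {z | K / M⁻¹ < |z c|} with hU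
  have hUmeas : MeasurableSet U := by
    refine MeasurableSet.union (MeasurableSet.iUnion fun c₀ =>
      (isOpen_nearDependent _ _ _ _ _).measurableSet.inter ?_)
      (MeasurableSet.iUnion fun c => measurableSet_lt measurable_const (by fun_prop))
    have : {z : Fin s × Fin n × Fin m → ℝ | ∀ c, |z c| ≤ K / M⁻¹} =
        ⋂ c, {z | |z c| ≤ K / M⁻¹} := by ext; simp
    rw [this]
    exact MeasurableSet.iInter fun c => measurableSet_le (by fun_prop) measurable_const
  have hmap := map_uncurry_gaussianBlocks s n m ρ
  have hsub : {G : Fin s → Fin n → Fin m → ℝ |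
      ¬ ((∀ i, Module.finrank ℝ (colSpan (P i + Matrix.of (G i))) = m) ∧
        ∀ V : Fin s → Matrix (Fin n) (Fin m) ℝ,
          (∀ i, IsOrthonormalBasisOf (V i) (colSpan (P i + Matrix.of (G i)))) →
          f * (ε / (4 * b)) ^ L / (2 * g * (1 + K) ^ ((e + 1) * D₀) *
            ((e + 1).factorial * (1 + K) ^ (e + 1))) *
            (min ρ 1 / (n : ℝ)) ^ ((e + 1 + 1) * L + (e + 1) * D₀ + 4 * (e + 1)) ≤
              leastSingularValue (blockLift (e + 1) V))} ⊆
      (fun G (c : Fin s × Fin n × Fin m) => G c.1 c.2.1 c.2.2) ⁻¹' U := by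
    intro G hG
    by_contra hGU
    apply hG
    have hbox : ∀ c : Fin s × Fin n × Fin m, |G c.1 c.2.1 c.2.2| ≤ K / M⁻¹ := by
      intro c
      by_contra hc
      exact hGU (Or.inr (Set.mem_iUnion.2 ⟨c, not_le.1 hc⟩))
    obtain ⟨h1, h2⟩ := finrank_and_le_of_not_nearDependent (e := e) hs hm hmn.le hcard hPle hlam
      hlam1 hK0.le hτ0 (z := fun c => G c.1 c.2.1 c.2.2) hbox fun c₀ hc₀ =>
        hGU (Or.inl (Set.mem_iUnion.2 ⟨c₀, hc₀, hbox⟩))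
    refine ⟨h1, fun V hV => le_trans ?_ (h2 V hV)⟩
    exact threshold_ge hn1 hρ hf0 hε0 hb0 hK0.le hg0 (by positivity)
  calc _ ≤ gaussianBlocks s n m ρ
        ((fun G (c : Fin s × Fin n × Fin m) => G c.1 c.2.1 c.2.2) ⁻¹' U) := measure_mono hsub
    _ = Measure.pi (fun _ => gaussianReal 0 v) U := by
        rw [← Measure.map_apply (by fun_prop) hUmeas, hmap]
    _ ≤ (∑ _c₀ : Fin s × NondecTuple (e + 1) m,
          ENNReal.ofReal ((Real.exp (-3) / (n : ℝ) ^ (e + 1)) ^ q)) +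
        ∑ _c : Fin s × Fin n × Fin m, ENNReal.ofReal (2 * Real.exp (-(K ^ 2 * n / 2))) := by
        refine (measure_union_le _ _).trans (add_le_add ?_ ?_)
        · exact (measure_iUnion_fintype_le _ _).trans (Finset.sum_le_sum fun c₀ _ => hleaf c₀)
        · exact (measure_iUnion_fintype_le _ _).trans (Finset.sum_le_sum fun c _ => htail c)
    _ = ENNReal.ofReal (((s * Fintype.card (NondecTuple (e + 1) m) : ℕ) : ℝ) *
          (Real.exp (-3) / (n : ℝ) ^ (e + 1)) ^ q +
        ((s * (n * m) : ℕ) : ℝ) * (2 * Real.exp (-(K ^ 2 * n / 2)))) := by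
        rw [Finset.sum_const, Finset.sum_const, Finset.card_univ, Finset.card_univ,
          Fintype.card_prod, Fintype.card_prod, Fintype.card_prod, Fintype.card_fin,
          Fintype.card_fin, Fintype.card_fin, nsmul_eq_mul, nsmul_eq_mul,
          ENNReal.ofReal_add (by positivity) (by positivity), 
          ENNReal.ofReal_mul (p := ((s * Fintype.card (NondecTuple (e + 1) m) : ℕ) : ℝ))
            (by positivity),
          ENNReal.ofReal_mul (p := ((s * (n * m) : ℕ) : ℝ)) (by positivity), ENNReal.ofReal_natCast, ENNReal.ofReal_natCast]
    _ ≤ ENNReal.ofReal (Real.exp (-(3 * q)) + 2 * Real.exp (-(3 * n))) := by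
        refine ENNReal.ofReal_le_ofReal (add_le_add (column_sum_le hn hcard hq1) ?_)
        rw [hK]
        refine tail_sum_le hn (k := e + 3) ?_
        have hpos : 0 < Fintype.card (NondecTuple (e + 1) m) :=
          Fintype.card_pos_iff.2 ⟨⟨fun _ => ⟨0, hm⟩, fun _ _ _ => le_rfl⟩⟩
        calc s * (n * m) ≤ n ^ (e + 1) * (n * n) :=
              Nat.mul_le_mul ((Nat.le_mul_of_pos_right _ hpos).trans hcard)
                (Nat.mul_le_mul_left _ hmn.le)
          _ = n ^ (e + 3) := by ring
    _ ≤ _ := by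
        refine ENNReal.ofReal_le_ofReal (exp_sum_le ?_ hn1 hq1r ?_)
        · have h1 : 1 / (4 * (D₀ : ℝ) * (e + 1) ^ 2) ≤ 1 := by
            rw [div_le_one (by positivity)]
            nlinarith [sq_nonneg (e : ℝ), Nat.cast_nonneg (α := ℝ) e]
          nlinarith
        -- The half in the rate absorbs the rounding: `x < q + 1 ≤ 2 * q`.
        · have : (1 - δ) * (1 / (4 * D₀ * (e + 1) ^ 2)) / 2 * (n : ℝ) = x / 2 := by
            rw [hx]; ring
          rw [this]
          linarith
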